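/- Let $k$ be an algebraically closed field, let $G$ be a connected affine algebraic group over $k$ with algebra of regular functions $k[G]$ and field of rational functions $k(G)=\operatorname{Fract} k[G]$, and let $R$ be an associative unital $k$-algebra on which $G$ acts rationally by $k$-algebra automorphisms (every orbit spans a finite-dimensional subspace, and for each finite-dimensional $G$-stable subspace $V\subseteq R$ the map $G\to \mathrm{GL}(V)$ is a homomorphism of algebraic groups). For a ring $S$, the right Amitsur–Martindale ring of quotients is $Q_r(S)=\varinjlim_J \operatorname{Hom}(J_S,S_S)$, where $J$ runs over the two-sided ideals of $S$ with zero left annihilator $\{s\in S : sJ=0\}$, and the extended centroid $\mathcal C(S)$ is the center of $Q_r(S)$; automorphisms of $S$ extend to $Q_r(S)$ and $\mathcal C(S)$. A prime ideal $P$ of $R$ is rational if $\mathcal C(R/P)=k$; $\operatorname{Rat}R$ is the set of rational ideals. A proper $G$-stable ideal $I$ of $R$ is $G$-prime if $AB\subseteq I$ implies $A\subseteq I$ or $B\subseteq I$ for all $G$-stable ideals $A,B$ of $R$, and a $G$-prime ideal $I$ is $G$-rational if $\mathcal C(R/I)^G=k$. Write $(P:G)=\bigcap_{g\in G}g.P$.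 Theorem. Let $I$ be a $G$-rational ideal of $R$, let $\operatorname{Rat}_I R=\{P\in\operatorname{Rat}R : (P:G)=I\}$ with the $G$-action $P\mapsto g.P$, and let $\operatorname{Hom}_G(\mathcal C(R/I),k(G))$ be the set of all $k$-algebra homomorphisms $\psi:\mathcal C(R/I)\to k(G)$ that are $G$-equivariant for the right regular action $\rho_r$ on $k(G)$ (on $k[G]$: $(\rho_r(x)f)(y)=f(yx)$), with the $G$-action $g.\psi=\rho_\ell(g)\circ\psi$ given by the left regular action (on $k[G]$: $(\rho_\ell(x)f)(y)=f(x^{-1}y)$). Then there is a $G$-equivariant bijection $$\operatorname{Rat}_I R\longrightarrow \operatorname{Hom}_G(\mathcal C(R/I),k(G)).$$ -/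

import Mathlib

noncomputable section

namespace RationalIdeals

/-! ### The Amitsur-Martindale ring of right quotients and the extended centroid -/

section Quotients

/-- The two-sided ideals `I` of `R` with zero left annihilator `{r | r I = 0}`. -/
def IsDense {R : Type*} [Ring R] (I : TwoSidedIdeal R) : Prop :=
  ∀ r : R, (∀ x ∈ I, r * x = 0) → r = 0

/-- The product ideal `I J`, consisting of all finite sums of products `x y`, `x ∈ I`, `y ∈ J`. -/
def idealMul {R : Type*} [Ring R] (I J : TwoSidedIdeal R) : TwoSidedIdeal R :=
  (TwoSidedIdeal.asIdeal I * TwoSidedIdeal.asIdeal J).toTwoSided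

variable {R : Type*} [Ring R]

theorem mul_mem_idealMul {I J : TwoSidedIdeal R} {x y : R} (hx : x ∈ I) (hy : y ∈ J) :
    x * y ∈ idealMul I J := by
  rw [idealMul, Ideal.mem_toTwoSided]
  exact Ideal.mul_mem_mul (TwoSidedIdeal.mem_asIdeal.2 hx) (TwoSidedIdeal.mem_asIdeal.2 hy)

theorem idealMul_induction {I J : TwoSidedIdeal R} {C : R → Prop}
    (hm : ∀ x ∈ I, ∀ y ∈ J, C (x * y)) (ha : ∀ x y, C x → C y → C (x + y))
    {z : R} (hz : z ∈ idealMul I J) : C z := by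
  rw [idealMul, Ideal.mem_toTwoSided] at hz
  exact Submodule.mul_induction_on hz
    (fun x hx y hy => hm x (TwoSidedIdeal.mem_asIdeal.1 hx) y (TwoSidedIdeal.mem_asIdeal.1 hy)) ha

theorem idealMul_le_left (I J : TwoSidedIdeal R) : idealMul I J ≤ I := fun _ hz =>
  idealMul_induction (C := fun z => z ∈ I) (fun x hx y _ => I.mul_mem_right x y hx)
    (fun _ _ h h' => I.add_mem h h') hz

theorem idealMul_le_right (I J : TwoSidedIdeal R) : idealMul I J ≤ J := fun _ hz =>
  idealMul_induction (C := fun z => z ∈ J) (fun x _ y hy => J.mul_mem_left x y hy)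
    (fun _ _ h h' => J.add_mem h h') hz

theorem IsDense.mono {I J : TwoSidedIdeal R} (hI : IsDense I) (h : I ≤ J) : IsDense J :=
  fun r hr => hI r fun x hx => hr x (h hx)

theorem IsDense.idealMul {I J : TwoSidedIdeal R} (hI : IsDense I) (hJ : IsDense J) :
    IsDense (idealMul I J) := fun r hr =>
  hI r fun x hx => hJ _ fun y hy => by rw [mul_assoc]; exact hr _ (mul_mem_idealMul hx hy)

theorem IsDense.inf {I J : TwoSidedIdeal R} (hI : IsDense I) (hJ : IsDense J) :
    IsDense (I ⊓ J) :=
  (hI.idealMul hJ).mono (le_inf (idealMul_le_left I J) (idealMul_le_right I J))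

theorem isDense_top : IsDense (⊤ : TwoSidedIdeal R) := fun r hr => by
  simpa using hr 1 (TwoSidedIdeal.mem_top R)

variable (R) in
/-- A right `R`-module map `f : I → R` on a two-sided ideal `I` with zero left annihilator. -/
structure PartialMap where
  /-- the domain `I` -/
  dom : TwoSidedIdeal R
  isDense : IsDense dom
  /-- the right `R`-linear map -/
  map : dom →ₗ[Rᵐᵒᵖ] R

namespace PartialMap

theorem map_mul_right (f : PartialMap R) {x : R} (hx : x ∈ f.dom) (r : R) (h : x * r ∈ f.dom) :
    f.map ⟨x * r, h⟩ = f.map ⟨x, hx⟩ * r :=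
  f.map.map_smul (MulOpposite.op r) ⟨x, hx⟩

theorem map_add_mk (f : PartialMap R) {x y : R} (hx : x ∈ f.dom) (hy : y ∈ f.dom)
    (h : x + y ∈ f.dom) : f.map ⟨x + y, h⟩ = f.map ⟨x, hx⟩ + f.map ⟨y, hy⟩ :=
  f.map.map_add ⟨x, hx⟩ ⟨y, hy⟩

/-- Build a partial map from a function on the ideal. -/
def mk' (I : TwoSidedIdeal R) (hI : IsDense I) (f : I → R)
    (hadd : ∀ x y (hx : x ∈ I) (hy : y ∈ I),
      f ⟨x + y, I.add_mem hx hy⟩ = f ⟨x, hx⟩ + f ⟨y, hy⟩)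
    (hmul : ∀ x r (hx : x ∈ I), f ⟨x * r, I.mul_mem_right x r hx⟩ = f ⟨x, hx⟩ * r) :
    PartialMap R where
  dom := I
  isDense := hI
  map :=
    { toFun := f
      map_add' := fun x y => hadd x.1 y.1 x.2 y.2
      map_smul' := fun r x => hmul x.1 r.unop x.2 }

/-- Two partial maps are equivalent if they agree on some dense ideal inside both domains. -/
def Equivalent (f g : PartialMap R) : Prop :=
  ∃ J : TwoSidedIdeal R, IsDense J ∧ J ≤ f.dom ∧ J ≤ g.dom ∧
    ∀ x ∈ J, ∀ (hf : x ∈ f.dom) (hg : x ∈ g.dom), f.map ⟨x, hf⟩ = g.map ⟨x, hg⟩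

variable (R) in
/-- Equivalence of partial maps as a setoid. -/
instance setoid : Setoid (PartialMap R) where
  r := Equivalent
  iseqv :=
    { refl := fun f => ⟨f.dom, f.isDense, le_rfl, le_rfl, fun _ _ _ _ => rfl⟩
      symm := fun ⟨J, hJ, hf, hg, h⟩ => ⟨J, hJ, hg, hf, fun x hx k k' => (h x hx k' k).symm⟩
      trans := fun ⟨J, hJ, hf, hg, h⟩ ⟨J', hJ', hg', hk, h'⟩ =>
        ⟨J ⊓ J', hJ.inf hJ', inf_le_left.trans hf, inf_le_right.trans hk, fun x hx k k' =>
          (h x ((TwoSidedIdeal.mem_inf R).1 hx).1 k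
            (hg ((TwoSidedIdeal.mem_inf R).1 hx).1)).trans
          (h' x ((TwoSidedIdeal.mem_inf R).1 hx).2
            (hg' ((TwoSidedIdeal.mem_inf R).1 hx).2) k')⟩ }

theorem equivalent_of_forall {f g : PartialMap R}
    (h : ∀ x (hf : x ∈ f.dom) (hg : x ∈ g.dom), f.map ⟨x, hf⟩ = g.map ⟨x, hg⟩) : f ≈ g :=
  ⟨f.dom ⊓ g.dom, f.isDense.inf g.isDense, inf_le_left, inf_le_right, fun x _ => h x⟩

/-- The sum `f + g`, defined on `dom f ∩ dom g`. -/
def add (f g : PartialMap R) : PartialMap R :=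
  mk' (f.dom ⊓ g.dom) (f.isDense.inf g.isDense)
    (fun x => f.map ⟨x.1, ((TwoSidedIdeal.mem_inf R).1 x.2).1⟩ +
      g.map ⟨x.1, ((TwoSidedIdeal.mem_inf R).1 x.2).2⟩)
    (fun x y hx hy => by
      have hx' := (TwoSidedIdeal.mem_inf R).1 hx
      have hy' := (TwoSidedIdeal.mem_inf R).1 hy
      rw [f.map_add_mk hx'.1 hy'.1, g.map_add_mk hx'.2 hy'.2]; abel)
    (fun x r hx => by
      have hx' := (TwoSidedIdeal.mem_inf R).1 hx
      rw [f.map_mul_right hx'.1, g.map_mul_right hx'.2, add_mul])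

theorem map_mem_of_mem_idealMul (g : PartialMap R) {I : TwoSidedIdeal R} {x : R}
    (hx : x ∈ idealMul g.dom I) : g.map ⟨x, idealMul_le_left _ _ hx⟩ ∈ I := by
  have : ∃ h : x ∈ g.dom, g.map ⟨x, h⟩ ∈ I :=
    idealMul_induction (C := fun x => ∃ h : x ∈ g.dom, g.map ⟨x, h⟩ ∈ I)
      (fun x hx y hy => ⟨g.dom.mul_mem_right x y hx, by
        rw [g.map_mul_right hx]; exact I.mul_mem_left _ _ hy⟩)
      (fun x y ⟨hx, hx'⟩ ⟨hy, hy'⟩ => ⟨g.dom.add_mem hx hy, by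
        rw [g.map_add_mk hx hy]; exact I.add_mem hx' hy'⟩) hx
  exact this.2

/-- The composite `f ∘ g`, defined on the ideal product `(dom g) (dom f)`. -/
def comp (f g : PartialMap R) : PartialMap R :=
  mk' (idealMul g.dom f.dom) (g.isDense.idealMul f.isDense)
    (fun x => f.map ⟨g.map ⟨x.1, idealMul_le_left _ _ x.2⟩, g.map_mem_of_mem_idealMul x.2⟩)
    (fun x y hx hy => by
      rw [← f.map_add_mk (g.map_mem_of_mem_idealMul hx) (g.map_mem_of_mem_idealMul hy)
        (f.dom.add_mem (g.map_mem_of_mem_idealMul hx) (g.map_mem_of_mem_idealMul hy))]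
      congr 2
      exact g.map_add_mk (idealMul_le_left _ _ hx) (idealMul_le_left _ _ hy) _)
    (fun x r hx => by
      rw [← f.map_mul_right (g.map_mem_of_mem_idealMul hx) r
        (f.dom.mul_mem_right _ _ (g.map_mem_of_mem_idealMul hx))]
      congr 2
      exact g.map_mul_right (idealMul_le_left _ _ hx) r _)

/-- The negative `-f`. -/
def neg (f : PartialMap R) : PartialMap R := ⟨f.dom, f.isDense, -f.map⟩

/-- Left multiplication `x ↦ r x` by an element `r` of `R`, defined on all of `R`. -/
def leftMul (r : R) : PartialMap R :=
  mk' ⊤ isDense_top (fun x => r * x.1) (fun x y _ _ => mul_add r x y)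
    (fun x s _ => (mul_assoc r x s).symm)

/-- Transport of a partial map along a ring isomorphism `e`: the map `e(x) ↦ e(f(x))`
on the ideal `e(dom f)`. -/
def transport {S : Type*} [Ring S] (e : R ≃+* S) (f : PartialMap R) : PartialMap S :=
  mk' (f.dom.comap e.symm)
    (fun s hs => by
      have := f.isDense (e.symm s) fun x hx => by
        have := hs (e x) (by simpa [TwoSidedIdeal.mem_comap] using hx)
        simpa using congrArg e.symm this
      simpa using this)
    (fun x => e (f.map ⟨e.symm x.1, (TwoSidedIdeal.mem_comap e.symm).1 x.2⟩))
    (fun x y hx hy => by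
      rw [← map_add, ← f.map_add_mk]
      · simp
      · simpa using f.dom.add_mem ((TwoSidedIdeal.mem_comap e.symm).1 hx)
          ((TwoSidedIdeal.mem_comap e.symm).1 hy))
    (fun x r hx => by
      conv_rhs => rw [← e.apply_symm_apply r]
      rw [← map_mul, ← f.map_mul_right]
      · simp
      · exact f.dom.mul_mem_right _ _ ((TwoSidedIdeal.mem_comap e.symm).1 hx))

theorem eval_add (f g : PartialMap R) {x : R} (h : x ∈ (add f g).dom) :
    (add f g).map ⟨x, h⟩ = f.map ⟨x, ((TwoSidedIdeal.mem_inf R).1 h).1⟩ +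
      g.map ⟨x, ((TwoSidedIdeal.mem_inf R).1 h).2⟩ := rfl

theorem eval_comp (f g : PartialMap R) {x : R} (h : x ∈ (comp f g).dom) :
    (comp f g).map ⟨x, h⟩ =
      f.map ⟨g.map ⟨x, idealMul_le_left _ _ h⟩, g.map_mem_of_mem_idealMul h⟩ := rfl

theorem eval_neg (f : PartialMap R) {x : R} (h : x ∈ (neg f).dom) :
    (neg f).map ⟨x, h⟩ = -f.map ⟨x, h⟩ := rfl

theorem eval_leftMul (r : R) {x : R} (h : x ∈ (leftMul r).dom) :
    (leftMul r).map ⟨x, h⟩ = r * x := rfl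

theorem eval_transport {S : Type*} [Ring S] (e : R ≃+* S) (f : PartialMap R) {x : S}
    (h : x ∈ (transport e f).dom) :
    (transport e f).map ⟨x, h⟩ =
      e (f.map ⟨e.symm x, (TwoSidedIdeal.mem_comap e.symm).1 h⟩) := rfl

theorem add_congr {f f' g g' : PartialMap R} (hf : f ≈ f') (hg : g ≈ g') :
    add f g ≈ add f' g' := by
  obtain ⟨J, hJ, h1, h2, h⟩ := hf
  obtain ⟨K, hK, k1, k2, k⟩ := hg
  exact ⟨J ⊓ K, hJ.inf hK, inf_le_inf h1 k1, inf_le_inf h2 k2, fun x hx hf hg => by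
    rw [eval_add, eval_add, h x ((TwoSidedIdeal.mem_inf R).1 hx).1,
      k x ((TwoSidedIdeal.mem_inf R).1 hx).2]⟩

theorem idealMul_mono {I I' J J' : TwoSidedIdeal R} (h : I ≤ I') (k : J ≤ J') :
    idealMul I J ≤ idealMul I' J' := fun _ hz =>
  idealMul_induction (C := fun z => z ∈ idealMul I' J')
    (fun _ hx _ hy => mul_mem_idealMul (h hx) (k hy))
    (fun _ _ h h' => TwoSidedIdeal.add_mem _ h h') hz

theorem comp_congr {f f' g g' : PartialMap R} (hf : f ≈ f') (hg : g ≈ g') :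
    comp f g ≈ comp f' g' := by
  obtain ⟨J, hJ, h1, h2, h⟩ := hf
  obtain ⟨K, hK, k1, k2, k⟩ := hg
  refine ⟨idealMul K J, hK.idealMul hJ, idealMul_mono k1 h1, idealMul_mono k2 h2,
    fun x hx hf hg => ?_⟩
  have key : ∃ hxK : x ∈ K, g.map ⟨x, k1 hxK⟩ ∈ J :=
    idealMul_induction (C := fun x => ∃ hxK : x ∈ K, g.map ⟨x, k1 hxK⟩ ∈ J)
      (fun x hx y hy => ⟨K.mul_mem_right x y hx, by
        rw [g.map_mul_right (k1 hx)]; exact J.mul_mem_left _ _ hy⟩)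
      (fun x y ⟨hx, hx'⟩ ⟨hy, hy'⟩ => ⟨K.add_mem hx hy, by
        rw [g.map_add_mk (k1 hx) (k1 hy)]; exact J.add_mem hx' hy'⟩) hx
  obtain ⟨hxK, hgJ⟩ := key
  rw [eval_comp, eval_comp, h _ hgJ _ (h2 hgJ)]
  congr 2
  exact k x hxK _ _

theorem neg_congr {f f' : PartialMap R} (hf : f ≈ f') : neg f ≈ neg f' := by
  obtain ⟨J, hJ, h1, h2, h⟩ := hf
  exact ⟨J, hJ, h1, h2, fun x hx hf hg => by
    rw [eval_neg, eval_neg, h x hx hf hg]⟩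

theorem transport_congr {S : Type*} [Ring S] (e : R ≃+* S) {f f' : PartialMap R} (hf : f ≈ f') :
    transport e f ≈ transport e f' := by
  obtain ⟨J, hJ, h1, h2, h⟩ := hf
  have hc {A B : TwoSidedIdeal R} (hAB : A ≤ B) : A.comap e.symm ≤ B.comap e.symm :=
    fun x hx => (TwoSidedIdeal.mem_comap e.symm).2 (hAB ((TwoSidedIdeal.mem_comap e.symm).1 hx))
  refine ⟨J.comap e.symm, (transport e ⟨J, hJ, 0⟩).isDense, hc h1, hc h2,
    fun x hx hf hg => ?_⟩
  rw [eval_transport, eval_transport, h _ ((TwoSidedIdeal.mem_comap e.symm).1 hx)]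

end PartialMap

variable (R) in
/-- The right Amitsur-Martindale ring of quotients `Q_r(R)`, the direct limit of the groups
`Hom(I_R, R_R)` over the two-sided ideals `I` of `R` with zero left annihilator. -/
def MartindaleQuotient : Type _ := Quotient (PartialMap.setoid R)

namespace MartindaleQuotient

open PartialMap

/-- The class of a partial map. -/
def mk (f : PartialMap R) : MartindaleQuotient R := Quotient.mk _ f

instance : Add (MartindaleQuotient R) := ⟨Quotient.map₂ add fun _ _ h _ _ h' => add_congr h h'⟩
instance : Mul (MartindaleQuotient R) := ⟨Quotient.map₂ comp fun _ _ h _ _ h' => comp_congr h h'⟩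
instance : Neg (MartindaleQuotient R) := ⟨Quotient.map neg fun _ _ h => neg_congr h⟩
instance : Zero (MartindaleQuotient R) := ⟨mk (leftMul 0)⟩
instance : One (MartindaleQuotient R) := ⟨mk (leftMul 1)⟩

theorem mk_add (f g : PartialMap R) : mk f + mk g = mk (add f g) := rfl
theorem mk_mul (f g : PartialMap R) : mk f * mk g = mk (comp f g) := rfl
theorem neg_mk (f : PartialMap R) : -mk f = mk (neg f) := rfl
theorem zero_def : (0 : MartindaleQuotient R) = mk (leftMul 0) := rfl
theorem one_def : (1 : MartindaleQuotient R) = mk (leftMul 1) := rfl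

theorem ind {C : MartindaleQuotient R → Prop} (h : ∀ f, C (mk f)) (q : MartindaleQuotient R) :
    C q := Quotient.ind h q

theorem mk_eq {f g : PartialMap R}
    (h : ∀ x (hf : x ∈ f.dom) (hg : x ∈ g.dom), f.map ⟨x, hf⟩ = g.map ⟨x, hg⟩) :
    mk f = mk g := Quotient.sound (equivalent_of_forall h)

instance : Ring (MartindaleQuotient R) where
  add_assoc a b c := by
    induction a using ind; induction b using ind; induction c using ind
    exact mk_eq fun x _ _ => by simp only [eval_add, add_assoc]
  zero_add a := by
    induction a using ind
    exact mk_eq fun x _ _ => by simp only [eval_add, eval_leftMul, zero_mul, zero_add]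
  add_zero a := by
    induction a using ind
    exact mk_eq fun x _ _ => by simp only [eval_add, eval_leftMul, zero_mul, add_zero]
  add_comm a b := by
    induction a using ind; induction b using ind
    exact mk_eq fun x _ _ => by simp only [eval_add, add_comm]
  neg_add_cancel a := by
    induction a using ind
    exact mk_eq fun x _ _ => by
      simp only [eval_add, eval_neg, eval_leftMul, zero_mul, neg_add_cancel]
  mul_assoc a b c := by
    induction a using ind; induction b using ind; induction c using ind
    exact mk_eq fun x _ _ => by simp only [eval_comp]
  one_mul a := by
    induction a using ind
    exact mk_eq fun x _ _ => by simp only [eval_comp, eval_leftMul, one_mul]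
  mul_one a := by
    induction a using ind
    exact mk_eq fun x _ _ => by simp only [eval_comp, eval_leftMul, one_mul]
  zero_mul a := by
    induction a using ind
    exact mk_eq fun x _ _ => by simp only [eval_comp, eval_leftMul, zero_mul]
  mul_zero a := by
    induction a using ind with | _ f
    exact mk_eq fun x _ _ => by
      simp only [eval_comp, eval_leftMul, zero_mul]
      exact f.map.map_zero
  left_distrib a b c := by
    induction a using ind with | _ f
    induction b using ind; induction c using ind
    refine mk_eq fun x _ hg => ?_
    simp only [eval_comp, eval_add]
    exact f.map_add_mk _ _ _
  right_distrib a b c := by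
    induction a using ind; induction b using ind; induction c using ind
    exact mk_eq fun x _ _ => by simp only [eval_comp, eval_add]
  nsmul := nsmulRec
  zsmul := zsmulRec

variable (R) in
/-- The canonical ring homomorphism `R → Q_r(R)`, sending `r` to the class of `x ↦ r x`. -/
def ofRing : R →+* MartindaleQuotient R where
  toFun r := mk (leftMul r)
  map_one' := rfl
  map_zero' := rfl
  map_mul' r s := mk_eq fun x _ _ => by simp only [eval_comp, eval_leftMul, mul_assoc]
  map_add' r s := mk_eq fun x _ _ => by simp only [eval_add, eval_leftMul, add_mul]

theorem ofRing_commute (a : R) (ha : ∀ x, a * x = x * a) (q : MartindaleQuotient R) :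
    ofRing R a * q = q * ofRing R a := by
  induction q using ind with | _ f
  refine mk_eq fun x hx hx' => ?_
  have hxf : x ∈ f.dom := idealMul_le_right _ _ hx'
  rw [eval_comp, eval_comp]
  simp only [eval_leftMul]
  rw [ha, ← f.map_mul_right hxf _ (f.dom.mul_mem_right _ _ hxf)]
  congr 2
  exact (ha x).symm

/-- If `R` is a `k`-algebra then so is `Q_r(R)`, through `k → R → Q_r(R)`. -/
instance instAlgebra {k : Type*} [Field k] [Algebra k R] : Algebra k (MartindaleQuotient R) :=
  ((ofRing R).comp (algebraMap k R)).toAlgebra' fun c q =>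
    ofRing_commute _ (Algebra.commutes c) q

theorem algebraMap_eq {k : Type*} [Field k] [Algebra k R] (c : k) :
    algebraMap k (MartindaleQuotient R) c = mk (leftMul (algebraMap k R c)) := rfl

section Transport

variable {k : Type*} [Field k] [Algebra k R] {S : Type*} [Ring S] [Algebra k S]
  {T : Type*} [Ring T] [Algebra k T]

/-- The homomorphism `Q_r(R) → Q_r(S)` induced by an isomorphism `e : R ≃ S`; the class of
`f : I → R` is sent to the class of `e(I) → S`, `e(x) ↦ e(f(x))`. -/
def transportHom (e : R ≃ₐ[k] S) : MartindaleQuotient R →ₐ[k] MartindaleQuotient S where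
  toFun := Quotient.map (transport e.toRingEquiv) fun _ _ h => transport_congr _ h
  map_one' := mk_eq fun x _ _ => by simp [eval_transport, eval_leftMul]
  map_zero' := mk_eq fun x _ _ => by simp [eval_transport, eval_leftMul]
  map_mul' a b := by
    induction a using ind; induction b using ind
    exact mk_eq fun x _ _ => by simp [eval_transport, eval_comp]
  map_add' a b := by
    induction a using ind; induction b using ind
    exact mk_eq fun x _ _ => by simp [eval_transport, eval_add]
  commutes' c := mk_eq fun x _ _ => by simp [eval_transport, eval_leftMul]

theorem transportHom_mk (e : R ≃ₐ[k] S) (f : PartialMap R) :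
    transportHom e (mk f) = mk (transport e.toRingEquiv f) := rfl

theorem transportHom_trans (e : R ≃ₐ[k] S) (e' : S ≃ₐ[k] T) (q : MartindaleQuotient R) :
    transportHom (e.trans e') q = transportHom e' (transportHom e q) := by
  induction q using ind
  exact mk_eq fun x _ _ => by simp [eval_transport]

theorem transportHom_refl (q : MartindaleQuotient R) :
    transportHom (AlgEquiv.refl : R ≃ₐ[k] R) q = q := by
  induction q using ind
  exact mk_eq fun x _ _ => by simp [eval_transport]

/-- The isomorphism `Q_r(R) ≃ Q_r(S)` induced by an isomorphism `R ≃ S`. -/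
def congr (e : R ≃ₐ[k] S) : MartindaleQuotient R ≃ₐ[k] MartindaleQuotient S :=
  AlgEquiv.ofAlgHom (transportHom e) (transportHom e.symm)
    (AlgHom.ext fun q => by
      rw [AlgHom.comp_apply, ← transportHom_trans, AlgEquiv.symm_trans_self, transportHom_refl]; rfl)
    (AlgHom.ext fun q => by
      rw [AlgHom.comp_apply, ← transportHom_trans, AlgEquiv.self_trans_symm, transportHom_refl]; rfl)

theorem congr_apply (e : R ≃ₐ[k] S) (q : MartindaleQuotient R) :
    congr e q = transportHom e q := rfl

end Transport

end MartindaleQuotient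

/-- The extended centroid `C(R)` of a `k`-algebra `R`: the center of `Q_r(R)`. -/
abbrev ExtendedCentroid (k : Type*) [Field k] (R : Type*) [Ring R] [Algebra k R] :
    Subalgebra k (MartindaleQuotient R) :=
  Subalgebra.center k (MartindaleQuotient R)

namespace ExtendedCentroid

variable {k : Type*} [Field k] [Algebra k R] {S : Type*} [Ring S] [Algebra k S]
  {T : Type*} [Ring T] [Algebra k T]

theorem congr_mem (e : R ≃ₐ[k] S) {q : MartindaleQuotient R} (hq : q ∈ ExtendedCentroid k R) :
    MartindaleQuotient.congr e q ∈ ExtendedCentroid k S := by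
  rw [Subalgebra.mem_center_iff] at hq ⊢
  intro b
  obtain ⟨a, rfl⟩ := (MartindaleQuotient.congr e).surjective b
  rw [← map_mul, ← map_mul, hq a]

/-- The homomorphism of extended centroids induced by an isomorphism of algebras. -/
def map (e : R ≃ₐ[k] S) : ExtendedCentroid k R →ₐ[k] ExtendedCentroid k S :=
  ((MartindaleQuotient.congr e).toAlgHom.comp (ExtendedCentroid k R).val).codRestrict _
    fun q => congr_mem e q.2

theorem coe_map (e : R ≃ₐ[k] S) (q : ExtendedCentroid k R) :
    (map e q : MartindaleQuotient S) = MartindaleQuotient.congr e q := rfl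

theorem map_trans (e : R ≃ₐ[k] S) (e' : S ≃ₐ[k] T) (q : ExtendedCentroid k R) :
    map (e.trans e') q = map e' (map e q) :=
  Subtype.ext (MartindaleQuotient.transportHom_trans e e' q.1)

theorem map_refl (q : ExtendedCentroid k R) : map (AlgEquiv.refl : R ≃ₐ[k] R) q = q :=
  Subtype.ext (MartindaleQuotient.transportHom_refl q.1)

end ExtendedCentroid

end Quotients

/-! ### Prime ideals, rational ideals and their analogues relative to a group action -/

section Ideals

/-- The residue ring `R / P` modulo a two-sided ideal. -/
abbrev ResidueRing {R : Type*} [Ring R] (P : TwoSidedIdeal R) : Type _ := P.ringCon.Quotient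

/-- `P` is a prime ideal of the (noncommutative) ring `R`: it is proper, and `A B ⊆ P` implies
`A ⊆ P` or `B ⊆ P` for two-sided ideals `A`, `B`. -/
def IsPrimeIdeal {R : Type*} [Ring R] (P : TwoSidedIdeal R) : Prop :=
  P ≠ ⊤ ∧ ∀ A B : TwoSidedIdeal R, idealMul A B ≤ P → A ≤ P ∨ B ≤ P

/-- A prime ideal `P` of the `k`-algebra `R` is rational if `C(R/P) = k`. -/
structure IsRational (k : Type*) [Field k] {R : Type*} [Ring R] [Algebra k R]
    (P : TwoSidedIdeal R) : Prop where
  isPrime : IsPrimeIdeal P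
  eq_base : ∀ c : ExtendedCentroid k (ResidueRing P), ∃ a : k, algebraMap k _ a = c

variable {k : Type*} [Field k] {R : Type*} [Ring R] [Algebra k R]

/-- The isomorphism `R/P ≃ R/Q` induced by an automorphism `e` of `R` with `e(P) = Q`. -/
def residueCongr (e : R ≃ₐ[k] R) (P Q : TwoSidedIdeal R) (h : ∀ x, x ∈ P ↔ e x ∈ Q) :
    ResidueRing P ≃ₐ[k] ResidueRing Q :=
  AlgEquiv.ofRingEquiv
    (f := RingCon.congr (c := P.ringCon) (d := Q.ringCon) e.toRingEquiv (RingCon.ext fun x y => by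
      rw [TwoSidedIdeal.rel_iff, h, map_sub, ← TwoSidedIdeal.rel_iff]; rfl))
    (fun a => congrArg (fun x : R => (x : ResidueRing Q)) (e.commutes a))

theorem residueCongr_coe (e : R ≃ₐ[k] R) (P Q : TwoSidedIdeal R) (h : ∀ x, x ∈ P ↔ e x ∈ Q)
    (x : R) : residueCongr e P Q h (x : ResidueRing P) = (e x : ResidueRing Q) := rfl

variable {G : Type*} [Group G] [MulSemiringAction G R]

/-- The translate `g.P = {g.x | x ∈ P}` of a two-sided ideal. -/
def translate (g : G) (P : TwoSidedIdeal R) : TwoSidedIdeal R :=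
  P.comap (MulSemiringAction.toRingHom G R g⁻¹)

theorem mem_translate {g : G} {P : TwoSidedIdeal R} {x : R} :
    x ∈ translate g P ↔ g⁻¹ • x ∈ P := TwoSidedIdeal.mem_comap _

theorem coe_translate (g : G) (P : TwoSidedIdeal R) :
    (translate g P : Set R) = (fun x => g • x) '' (P : Set R) := by
  ext x
  simp only [SetLike.mem_coe, mem_translate, Set.mem_image]
  exact ⟨fun h => ⟨_, h, smul_inv_smul g x⟩, fun ⟨y, hy, h⟩ => by rwa [← h, inv_smul_smul]⟩

variable (G) in
/-- `(P : G) = ⋂_{g ∈ G} g.P`. -/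
def core (P : TwoSidedIdeal R) : TwoSidedIdeal R := ⨅ g : G, translate g P

variable (G) in
/-- `I` is stable under the action of `G`. -/
def IsStable (I : TwoSidedIdeal R) : Prop := ∀ g : G, ∀ x ∈ I, g • x ∈ I

variable (G) in
/-- `I` is a `G`-prime ideal: it is proper and `G`-stable, and `A B ⊆ I` implies `A ⊆ I` or
`B ⊆ I` for `G`-stable two-sided ideals `A`, `B`. -/
structure IsGPrime (I : TwoSidedIdeal R) : Prop where
  isStable : IsStable G I
  ne_top : I ≠ ⊤
  le_or_le : ∀ A B : TwoSidedIdeal R, IsStable G A → IsStable G B → idealMul A B ≤ I →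
    A ≤ I ∨ B ≤ I

variable [SMulCommClass G k R]

variable (k) in
/-- The automorphism of `R/I` given by the action of `g ∈ G`, for a `G`-stable ideal `I`. -/
def residueAut {I : TwoSidedIdeal R} (hI : IsStable G I) (g : G) :
    ResidueRing I ≃ₐ[k] ResidueRing I :=
  residueCongr (MulSemiringAction.toAlgEquiv k R g) I I fun x =>
    ⟨fun h => hI g x h, fun h => by simpa using hI g⁻¹ _ h⟩

theorem residueAut_mul {I : TwoSidedIdeal R} (hI : IsStable G I) (g h : G) :
    residueAut k hI (g * h) = (residueAut k hI h).trans (residueAut k hI g) := by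
  ext ⟨x⟩
  exact congrArg (fun x : R => (x : ResidueRing I)) (mul_smul g h x)

theorem residueAut_one {I : TwoSidedIdeal R} (hI : IsStable G I) :
    residueAut k hI (1 : G) = AlgEquiv.refl := by
  ext ⟨x⟩
  exact congrArg (fun x : R => (x : ResidueRing I)) (one_smul G x)

variable (k) in
/-- The action of `G` on the extended centroid `C(R/I)`, for a `G`-stable ideal `I`. -/
def centroidAction {I : TwoSidedIdeal R} (hI : IsStable G I) :
    G →* (ExtendedCentroid k (ResidueRing I) →ₐ[k] ExtendedCentroid k (ResidueRing I)) where
  toFun g := ExtendedCentroid.map (residueAut k hI g)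
  map_one' := AlgHom.ext fun q => by
    rw [residueAut_one, ExtendedCentroid.map_refl]; rfl
  map_mul' g h := AlgHom.ext fun q => by
    rw [residueAut_mul, ExtendedCentroid.map_trans]; rfl

variable (k G) in
/-- A `G`-prime ideal `I` is `G`-rational if `C(R/I)^G = k`. -/
structure IsGRational (I : TwoSidedIdeal R) : Prop where
  isGPrime : IsGPrime G I
  fixed_eq_base : ∀ c : ExtendedCentroid k (ResidueRing I),
    (∀ g : G, centroidAction k isGPrime.isStable g c = c) → ∃ a : k, algebraMap k _ a = c

theorem isRational_translate {P : TwoSidedIdeal R} (hP : IsRational k P) (g : G) :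
    IsRational k (translate g P) where
  isPrime := by
    have key : ∀ A : TwoSidedIdeal R, translate g⁻¹ A ≤ P → A ≤ translate g P := fun A h x hx => by
      rw [mem_translate]
      exact h (mem_translate.2 (by rwa [inv_inv, smul_inv_smul]))
    refine ⟨fun h => hP.isPrime.1 (eq_top_iff.2 fun x _ => ?_), fun A B h => ?_⟩
    · have : g • x ∈ translate g P := h ▸ TwoSidedIdeal.mem_top R
      rwa [mem_translate, inv_smul_smul] at this
    · refine (hP.isPrime.2 (translate g⁻¹ A) (translate g⁻¹ B) fun z hz => ?_).imp
        (key A) (key B)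
      refine idealMul_induction (C := fun z => z ∈ P) (fun x hx y hy => ?_)
        (fun _ _ => P.add_mem) hz
      rw [mem_translate, inv_inv] at hx hy
      have := h (mul_mem_idealMul hx hy)
      rwa [← smul_mul', mem_translate, inv_smul_smul] at this
  eq_base c := by
    let e : ResidueRing P ≃ₐ[k] ResidueRing (translate g P) :=
      residueCongr (MulSemiringAction.toAlgEquiv k R g) P (translate g P) fun x => by
        rw [mem_translate]; simp
    obtain ⟨a, ha⟩ := hP.eq_base (ExtendedCentroid.map e.symm c)
    refine ⟨a, ?_⟩
    rw [← AlgHom.commutes (ExtendedCentroid.map e), ha, ← ExtendedCentroid.map_trans,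
      AlgEquiv.symm_trans_self, ExtendedCentroid.map_refl]

theorem core_translate (P : TwoSidedIdeal R) (g : G) : core G (translate g P) = core G P := by
  ext x
  simp only [core, TwoSidedIdeal.mem_iInf, mem_translate]
  exact ⟨fun h i => by
      simpa only [mul_inv_rev, inv_inv, mul_smul, inv_smul_smul] using h (i * g⁻¹),
    fun h i => by simpa only [mul_inv_rev, inv_inv, mul_smul] using h (i * g)⟩

variable (k G) in
/-- The fibre `Rat_I R = {P ∈ Rat R | (P : G) = I}`. -/
def RatFibre (I : TwoSidedIdeal R) : Type _ :=
  {P : TwoSidedIdeal R // IsRational k P ∧ core G P = I}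

/-- `G` acts on the fibre `Rat_I R` by `P ↦ g.P`. -/
instance (I : TwoSidedIdeal R) : MulAction G (RatFibre k G I) where
  smul g P := ⟨translate g P.1, isRational_translate P.2.1 g, (core_translate P.1 g).trans P.2.2⟩
  one_smul P := Subtype.ext <| TwoSidedIdeal.ext fun x => by
    change x ∈ translate 1 P.1 ↔ _
    rw [mem_translate, inv_one, one_smul]
  mul_smul g h P := Subtype.ext <| TwoSidedIdeal.ext fun x => by
    change x ∈ translate (g * h) P.1 ↔ x ∈ translate g (translate h P.1)
    rw [mem_translate, mem_translate, mem_translate, mul_inv_rev, mul_smul]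

theorem RatFibre.coe_smul {I : TwoSidedIdeal R} (g : G) (P : RatFibre k G I) :
    (g • P).1 = translate g P.1 := rfl

end Ideals

/-! ### Affine algebraic groups, rational functions and rational actions -/

section AlgebraicGroups

/-- The structure of an affine algebraic group over the (algebraically closed) field `k` on the
group `G`: an algebra `k[G]` of `k`-valued functions, the regular functions on `G`, which is
finitely generated, has the points of `G` as its `k`-algebra homomorphisms to `k` (so that `G` is
an affine variety with coordinate ring `k[G]`), and for which multiplication `G × G → G` and
inversion `G → G` are morphisms. -/
class AffineAlgebraicGroup (k : Type*) [Field k] (G : Type*) [Group G] where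
  /-- the algebra `k[G]` of regular functions -/
  regular : Subalgebra k (G → k)
  fg : regular.FG
  eval_bijective : Function.Bijective fun (g : G) =>
    ((Pi.evalAlgHom k (fun _ : G => k) g).comp regular.val : regular →ₐ[k] k)
  mul_regular : ∀ f ∈ regular, ∃ (n : ℕ) (u v : Fin n → regular),
    ∀ x y : G, f (x * y) = ∑ i, (u i : G → k) x * (v i : G → k) y
  inv_regular : ∀ f ∈ regular, (fun x => f x⁻¹) ∈ regular

variable (k : Type*) [Field k] (G : Type*) [Group G] [AffineAlgebraicGroup k G]

/-- The algebra `k[G]` of regular functions on `G`. -/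
abbrev regularFunctions : Subalgebra k (G → k) := AffineAlgebraicGroup.regular

/-- The Zariski topology on `G`, with basis the sets `{x | f x ≠ 0}` for `f ∈ k[G]`. -/
@[reducible]
def zariskiTopology : TopologicalSpace G :=
  TopologicalSpace.generateFrom {U | ∃ f ∈ regularFunctions k G, U = {x | f x ≠ 0}}

/-- The algebraic group `G` is connected, in its Zariski topology. -/
def IsZariskiConnected : Prop := @ConnectedSpace G (zariskiTopology k G)

/-- `k(G)`, the ring of fractions of `k[G]` with respect to its non-zero-divisors. When `G` is
connected, `k[G]` is a domain and `k(G)` is the field of rational functions on `G`. -/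
abbrev RationalFunctions : Type _ := FractionRing (regularFunctions k G)

variable {k G}

theorem right_translate_mem {f : G → k} (hf : f ∈ regularFunctions k G) (x : G) :
    (fun y => f (y * x)) ∈ regularFunctions k G := by
  obtain ⟨n, u, v, h⟩ := AffineAlgebraicGroup.mul_regular f hf
  have : (fun y => f (y * x)) = ∑ i, (v i : G → k) x • (u i : G → k) := by
    ext y
    simp [h, Finset.sum_apply, mul_comm]
  rw [this]
  exact Subalgebra.sum_mem _ fun i _ => Subalgebra.smul_mem _ (u i).2 _

theorem left_translate_mem {f : G → k} (hf : f ∈ regularFunctions k G) (x : G) :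
    (fun y => f (x * y)) ∈ regularFunctions k G := by
  obtain ⟨n, u, v, h⟩ := AffineAlgebraicGroup.mul_regular f hf
  have : (fun y => f (x * y)) = ∑ i, (u i : G → k) x • (v i : G → k) := by
    ext y
    simp [h, Finset.sum_apply]
  rw [this]
  exact Subalgebra.sum_mem _ fun i _ => Subalgebra.smul_mem _ (v i).2 _

variable (k)

/-- The right regular representation on `k[G]`: `(ρ_r(x) f)(y) = f(y x)`. -/
def rightRegular (x : G) : regularFunctions k G ≃ₐ[k] regularFunctions k G where
  toFun f := ⟨fun y => f.1 (y * x), right_translate_mem f.2 x⟩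
  invFun f := ⟨fun y => f.1 (y * x⁻¹), right_translate_mem f.2 x⁻¹⟩
  left_inv f := Subtype.ext <| funext fun y => by simp
  right_inv f := Subtype.ext <| funext fun y => by simp
  map_mul' _ _ := rfl
  map_add' _ _ := rfl
  commutes' _ := rfl

/-- The left regular representation on `k[G]`: `(ρ_ℓ(x) f)(y) = f(x⁻¹ y)`. -/
def leftRegular (x : G) : regularFunctions k G ≃ₐ[k] regularFunctions k G where
  toFun f := ⟨fun y => f.1 (x⁻¹ * y), left_translate_mem f.2 x⁻¹⟩
  invFun f := ⟨fun y => f.1 (x * y), left_translate_mem f.2 x⟩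
  left_inv f := Subtype.ext <| funext fun y => by simp
  right_inv f := Subtype.ext <| funext fun y => by simp
  map_mul' _ _ := rfl
  map_add' _ _ := rfl
  commutes' _ := rfl

/-- The right regular action `ρ_r` of `G` on `k(G)`, extending the one on `k[G]`. -/
def rightRegularFrac (x : G) : RationalFunctions k G ≃ₐ[k] RationalFunctions k G :=
  IsFractionRing.algEquivOfAlgEquiv (rightRegular k x)

/-- The left regular action `ρ_ℓ` of `G` on `k(G)`, extending the one on `k[G]`. -/
def leftRegularFrac (x : G) : RationalFunctions k G ≃ₐ[k] RationalFunctions k G :=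
  IsFractionRing.algEquivOfAlgEquiv (leftRegular k x)

variable {k}

theorem rightRegularFrac_algebraMap (x : G) (f : regularFunctions k G) :
    rightRegularFrac k x (algebraMap _ (RationalFunctions k G) f) =
      algebraMap _ (RationalFunctions k G) (rightRegular k x f) :=
  IsFractionRing.algEquivOfAlgEquiv_algebraMap _ _

theorem leftRegularFrac_algebraMap (x : G) (f : regularFunctions k G) :
    leftRegularFrac k x (algebraMap _ (RationalFunctions k G) f) =
      algebraMap _ (RationalFunctions k G) (leftRegular k x f) :=
  IsFractionRing.algEquivOfAlgEquiv_algebraMap _ _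

theorem rationalFunctions_hom_ext {φ ψ : RationalFunctions k G →ₐ[k] RationalFunctions k G}
    (h : ∀ f : regularFunctions k G, φ (algebraMap _ _ f) = ψ (algebraMap _ _ f)) : φ = ψ :=
  AlgHom.coe_ringHom_injective <|
    IsLocalization.ringHom_ext (nonZeroDivisors (regularFunctions k G)) (RingHom.ext h)

theorem rightRegularFrac_one (q : RationalFunctions k G) : rightRegularFrac k (1 : G) q = q :=
  DFunLike.congr_fun (rationalFunctions_hom_ext
    (φ := (rightRegularFrac k (1 : G)).toAlgHom) (ψ := AlgHom.id k _)
    fun f => (rightRegularFrac_algebraMap 1 f).trans <| congrArg _ <| Subtype.ext <|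
      funext fun y => congrArg f.1 (mul_one y)) q

theorem rightRegularFrac_mul (g h : G) (q : RationalFunctions k G) :
    rightRegularFrac k (g * h) q = rightRegularFrac k g (rightRegularFrac k h q) :=
  DFunLike.congr_fun (rationalFunctions_hom_ext
    (φ := (rightRegularFrac k (g * h)).toAlgHom)
    (ψ := (rightRegularFrac k g).toAlgHom.comp (rightRegularFrac k h).toAlgHom)
    fun f => by
      change rightRegularFrac k (g * h) _ = rightRegularFrac k g (rightRegularFrac k h _)
      rw [rightRegularFrac_algebraMap, rightRegularFrac_algebraMap, rightRegularFrac_algebraMap]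
      exact congrArg _ (Subtype.ext <| funext fun y => congrArg f.1 (mul_assoc y g h).symm)) q

theorem leftRegularFrac_one (q : RationalFunctions k G) : leftRegularFrac k (1 : G) q = q :=
  DFunLike.congr_fun (rationalFunctions_hom_ext
    (φ := (leftRegularFrac k (1 : G)).toAlgHom) (ψ := AlgHom.id k _)
    fun f => (leftRegularFrac_algebraMap 1 f).trans <| congrArg _ <| Subtype.ext <|
      funext fun y => congrArg f.1 (by rw [inv_one, one_mul])) q

theorem leftRegularFrac_mul (g h : G) (q : RationalFunctions k G) :
    leftRegularFrac k (g * h) q = leftRegularFrac k g (leftRegularFrac k h q) :=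
  DFunLike.congr_fun (rationalFunctions_hom_ext
    (φ := (leftRegularFrac k (g * h)).toAlgHom)
    (ψ := (leftRegularFrac k g).toAlgHom.comp (leftRegularFrac k h).toAlgHom)
    fun f => by
      change leftRegularFrac k (g * h) _ = leftRegularFrac k g (leftRegularFrac k h _)
      rw [leftRegularFrac_algebraMap, leftRegularFrac_algebraMap, leftRegularFrac_algebraMap]
      exact congrArg _ (Subtype.ext <| funext fun y => congrArg f.1
        (by rw [mul_inv_rev, mul_assoc]))) q

theorem leftRegularFrac_rightRegularFrac (g h : G) (q : RationalFunctions k G) :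
    leftRegularFrac k g (rightRegularFrac k h q) = rightRegularFrac k h (leftRegularFrac k g q) :=
  DFunLike.congr_fun (rationalFunctions_hom_ext
    (φ := (leftRegularFrac k g).toAlgHom.comp (rightRegularFrac k h).toAlgHom)
    (ψ := (rightRegularFrac k h).toAlgHom.comp (leftRegularFrac k g).toAlgHom)
    fun f => by
      change leftRegularFrac k g (rightRegularFrac k h _) =
        rightRegularFrac k h (leftRegularFrac k g _)
      rw [leftRegularFrac_algebraMap, rightRegularFrac_algebraMap, leftRegularFrac_algebraMap,
        rightRegularFrac_algebraMap]
      exact congrArg _ (Subtype.ext <| funext fun y => congrArg f.1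
        (mul_assoc g⁻¹ y h))) q

variable (k G)

/-- The action of `G` on the `k`-vector space `M` is rational: every orbit spans a
finite-dimensional subspace, and `G → GL(V)` is a homomorphism of algebraic groups for every
finite-dimensional `G`-stable subspace `V`, that is, the matrix coefficients `g ↦ ξ(g.v)`
(`v ∈ V`, `ξ ∈ V^*`) are regular functions on `G`. -/
structure IsRationalAction (M : Type*) [AddCommGroup M] [Module k M] [DistribMulAction G M]
    [SMulCommClass G k M] : Prop where
  locallyFinite : ∀ m : M, FiniteDimensional k (Submodule.span k (MulAction.orbit G m))
  regular_coeff : ∀ (V : Submodule k M) (hV : ∀ g : G, ∀ v ∈ V, g • v ∈ V),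
    FiniteDimensional k V → ∀ (v : V) (ξ : Module.Dual k V),
      (fun g : G => ξ ⟨g • (v : M), hV g v v.2⟩) ∈ regularFunctions k G

variable {G} {R : Type*} [Ring R] [Algebra k R] [MulSemiringAction G R] [SMulCommClass G k R]

/-- `Hom_G(C(R/I), k(G))`: the `k`-algebra homomorphisms `C(R/I) → k(G)` that are equivariant for
the right regular action of `G` on `k(G)`. -/
def EquivariantHom {I : TwoSidedIdeal R} (hI : IsStable G I) : Type _ :=
  {ψ : ExtendedCentroid k (ResidueRing I) →ₐ[k] RationalFunctions k G //
    ∀ g c, ψ (centroidAction k hI g c) = rightRegularFrac k g (ψ c)}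

/-- `G` acts on `Hom_G(C(R/I), k(G))` by `g.ψ = ρ_ℓ(g) ∘ ψ`. -/
instance {I : TwoSidedIdeal R} (hI : IsStable G I) : MulAction G (EquivariantHom k hI) where
  smul g ψ := ⟨(leftRegularFrac k g).toAlgHom.comp ψ.1, fun h c =>
    (congrArg (leftRegularFrac k g) (ψ.2 h c)).trans (leftRegularFrac_rightRegularFrac g h _)⟩
  one_smul ψ := Subtype.ext <| AlgHom.ext fun c => leftRegularFrac_one (ψ.1 c)
  mul_smul g h ψ := Subtype.ext <| AlgHom.ext fun c => leftRegularFrac_mul g h (ψ.1 c)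

theorem EquivariantHom.coe_smul_apply {I : TwoSidedIdeal R} {hI : IsStable G I} (g : G)
    (ψ : EquivariantHom k hI) (c : ExtendedCentroid k (ResidueRing I)) :
    (g • ψ).1 c = leftRegularFrac k g (ψ.1 c) := rfl

end AlgebraicGroups

end RationalIdeals

end

/-!
Write `C` for the extended centroid of `R/I` and `Q` for its Martindale ring of quotients. As `G` is
connected, `k[G]` is a domain (`IsZariskiConnected.isDomain`) and the `G`-prime ideal `I` is prime
(`IsGPrime.isPrimeIdeal`), so that `C` is a field.

*From ideals to homomorphisms.* Let `P` be a rational ideal with `(P : G) = I`, and let `c ∈ C`, say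
`c a = b` in `Q` with `a, b ∈ R`, `a ∉ I`. For those `x ∈ G` with `x.a ∉ P`, the element `c`
induces an element of the extended centroid `k` of `R/P`, that is, a scalar `ψ(c)(x)` with
`x.b ≡ ψ(c)(x) x.a` modulo `P`. Applying a linear form that vanishes on `P` shows that `ψ(c)` is a
rational function on `G`, and `ψ : C → k(G)` is the homomorphism attached to `P`
(`IsCentroidValue`, `exists_algHom_isCentroidValue`). Equivariance is read off from the
characterisation of its values (`IsCentroidValue.eq_rightRegular`,
`IsCentroidValue.eq_leftRegular`).

*From homomorphisms to ideals.* Let `ψ : C → k(G)` be equivariant, and form `k(G) ⊗_C Q` along `ψ`.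
The class of the map `x ↦ x⁻¹.r` in `k[G] ⊗ R` has an image in `k(G) ⊗_C Q`, and the ideal attached
to `ψ` is the kernel of the resulting homomorphism `R → k(G) ⊗_C Q` (`orbitKer`). The argument
of Martindale shows that each nonzero subbimodule of `k(G) ⊗_C Q` contains a nonzero pure tensor
`1 ⊗ a` with `a ∈ R` (`IsMartindaleExtension.exists_mem_of_ne_zero`). It follows that the kernel is
prime, and that an element of its extended centroid is given by a scalar in `k(G)`. By equivariance
of `ψ` this scalar is invariant under right translations, hence lies in `k`
(`isRational_orbitKer`). The core of the kernel is `I` (`core_orbitKer`) and the homomorphism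
attached to it is `ψ` (`IsCentroidValue.eq_algebraMap`).

*Uniqueness.* Let `ψ` be attached to `P`. An element of the kernel of `k[G] ⊗ R → k(G) ⊗_C Q` is,
up to denominators, a combination of relations `∑ aᵢ rᵢ = 0` in `Q` with `aᵢ ∈ C`, and such a
relation translates into a congruence modulo `P` at each point of `G`. So every regular map `A` in
that kernel satisfies `x.A(x) ∈ P` for all `x`. Conversely, the maps `A` with `x.A(x) ∈ P` generate
a subbimodule of `k(G) ⊗_C Q`, which is zero because otherwise it would contain some `1 ⊗ a` with
`a ∉ I`, whence `x.a ∈ P` for all `x`. Hence `P` is the kernel of `R → k(G) ⊗_C Q`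
(`eq_orbitKer`).
-/

noncomputable section

namespace RationalIdeals

/-! ### Prime ideals, elementwise -/

section Prime

variable {R : Type*} [Ring R]

/-- The two-sided ideal of all `x` with `x R b ⊆ P` for every `b ∈ s`. -/
def leftColon (P : TwoSidedIdeal R) (s : Set R) : TwoSidedIdeal R :=
  .mk' {x | ∀ b ∈ s, ∀ r, x * r * b ∈ P}
    (fun b _ r => by simp)
    (fun hx hy b hb r => by rw [add_mul, add_mul]; exact P.add_mem (hx b hb r) (hy b hb r))
    (fun hx b hb r => by rw [neg_mul, neg_mul]; exact P.neg_mem (hx b hb r))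
    (fun {x y} hy b hb r => by
      rw [mul_assoc, mul_assoc, ← mul_assoc y]; exact P.mul_mem_left _ _ (hy b hb r))
    (fun {x y} hx b hb r => by rw [mul_assoc x]; exact hx b hb _)

theorem mem_leftColon {P : TwoSidedIdeal R} {s : Set R} {x : R} :
    x ∈ leftColon P s ↔ ∀ b ∈ s, ∀ r, x * r * b ∈ P := by
  simp only [leftColon, TwoSidedIdeal.mem_mk', Set.mem_ofPred_eq]

/-- The two-sided ideal of all `y` with `A y ⊆ P`. -/
def rightColon (P A : TwoSidedIdeal R) : TwoSidedIdeal R :=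
  .mk' {y | ∀ x ∈ A, x * y ∈ P}
    (fun x _ => by simp)
    (fun hx hy r hr => by rw [mul_add]; exact P.add_mem (hx r hr) (hy r hr))
    (fun hx r hr => by rw [mul_neg]; exact P.neg_mem (hx r hr))
    (fun {x y} hy r hr => by rw [← mul_assoc]; exact hy _ (A.mul_mem_right _ _ hr))
    (fun {x y} hx r hr => by rw [← mul_assoc]; exact P.mul_mem_right _ _ (hx _ hr))

theorem mem_rightColon {P A : TwoSidedIdeal R} {y : R} :
    y ∈ rightColon P A ↔ ∀ x ∈ A, x * y ∈ P := by
  simp only [rightColon, TwoSidedIdeal.mem_mk', Set.mem_ofPred_eq]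

theorem idealMul_rightColon_le (P A : TwoSidedIdeal R) : idealMul A (rightColon P A) ≤ P :=
  fun _ hz => idealMul_induction (C := fun z => z ∈ P)
    (fun x hx _ hy => mem_rightColon.1 hy x hx) (fun _ _ => P.add_mem) hz

theorem mem_rightColon_leftColon {P : TwoSidedIdeal R} {s : Set R} {b : R} (hb : b ∈ s) :
    b ∈ rightColon P (leftColon P s) :=
  mem_rightColon.2 fun x hx => by simpa using mem_leftColon.1 hx b hb 1

theorem IsPrimeIdeal.mem_or_mem {P : TwoSidedIdeal R} (hP : IsPrimeIdeal P) {a b : R}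
    (h : ∀ r, a * r * b ∈ P) : a ∈ P ∨ b ∈ P :=
  (hP.2 _ _ (idealMul_rightColon_le P (leftColon P {b}))).imp
    (fun h' => h' (mem_leftColon.2 fun _ hb r => hb ▸ h r))
    (fun h' => h' (mem_rightColon_leftColon rfl))

theorem isPrimeIdeal_of_mem_or_mem {P : TwoSidedIdeal R} (hP : P ≠ ⊤)
    (h : ∀ a b, (∀ r, a * r * b ∈ P) → a ∈ P ∨ b ∈ P) : IsPrimeIdeal P := by
  refine ⟨hP, fun A B hAB => or_iff_not_imp_left.2 fun hA b hb => ?_⟩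
  obtain ⟨a, ha, haP⟩ := Set.not_subset.1 hA
  exact (h a b fun r => hAB (mul_mem_idealMul (A.mul_mem_right _ _ ha) hb)).resolve_left haP

theorem IsPrimeIdeal.one_notMem {P : TwoSidedIdeal R} (hP : IsPrimeIdeal P) : (1 : R) ∉ P :=
  fun h => hP.1 (eq_top_iff.2 fun x _ => by simpa using P.mul_mem_left x 1 h)

theorem IsPrimeIdeal.exists_mul_mul_notMem {P : TwoSidedIdeal R} (hP : IsPrimeIdeal P) {a b : R}
    (ha : a ∉ P) (hb : b ∉ P) : ∃ r, a * r * b ∉ P := by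
  by_contra! h
  exact (hP.mem_or_mem h).elim ha hb

theorem IsPrimeIdeal.not_inf_le {P : TwoSidedIdeal R} (hP : IsPrimeIdeal P)
    {I J : TwoSidedIdeal R} (hI : ¬I ≤ P) (hJ : ¬J ≤ P) : ¬I ⊓ J ≤ P := fun h =>
  (hP.2 I J ((le_inf (idealMul_le_left I J) (idealMul_le_right I J)).trans h)).elim hI hJ

end Prime

/-! ### Graphs of partial bimodule maps and the Martindale extension of a prime ring -/

section Extension

variable {R : Type*} [Ring R]

/-- `W` is a sub-bimodule of `R × R` whose image in `R/P × R/P` is the graph of an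
`R`-bimodule map `J → R/P` defined on a nonzero two-sided ideal `J` of `R/P`. -/
structure IsBimoduleGraph (P : TwoSidedIdeal R) (W : R → R → Prop) : Prop where
  add : ∀ {a b a' b'}, W a b → W a' b' → W (a + a') (b + b')
  mul_left : ∀ {a b} r, W a b → W (r * a) (r * b)
  mul_right : ∀ {a b} r, W a b → W (a * r) (b * r)
  mem : ∀ {a b}, W a b → a ∈ P → b ∈ P
  exists_notMem : ∃ a b, W a b ∧ a ∉ P

namespace IsBimoduleGraph

variable {P : TwoSidedIdeal R} {W : R → R → Prop}

theorem zero (h : IsBimoduleGraph P W) : W 0 0 := by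
  obtain ⟨a, b, hab, -⟩ := h.exists_notMem
  simpa using h.mul_left 0 hab

theorem neg (h : IsBimoduleGraph P W) {a b : R} (hab : W a b) : W (-a) (-b) := by
  simpa using h.mul_left (-1) hab

theorem sub (h : IsBimoduleGraph P W) {a b a' b' : R} (hab : W a b) (hab' : W a' b') :
    W (a - a') (b - b') := by
  simpa [sub_eq_add_neg] using h.add hab (h.neg hab')

end IsBimoduleGraph

/-- For a prime ideal `P` of `R`, the properties of the map `ι : R → R/P → Q` to the right
Martindale ring of quotients `Q` of `R/P` and of the action on `Q` of the extended centroid `F`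
that are used below: elements of `Q` are fractions whose denominators form a nonzero ideal, and
every bimodule map from a nonzero ideal of `R/P` to `R/P` is multiplication by an element of `F`. -/
structure IsMartindaleExtension (F : Type*) [CommRing F] {Q : Type*} [Ring Q] [Algebra F Q]
    (P : TwoSidedIdeal R) (ι : R →+* Q) : Prop where
  isPrime : IsPrimeIdeal P
  eq_zero_iff : ∀ r, ι r = 0 ↔ r ∈ P
  exists_ideal : ∀ q, ∃ J : TwoSidedIdeal R, ¬J ≤ P ∧ ∀ x ∈ J, ∃ b, q * ι x = ι b
  eq_zero : ∀ q (J : TwoSidedIdeal R), ¬J ≤ P → (∀ x ∈ J, q * ι x = 0) → q = 0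
  exists_scalar : ∀ W : R → R → Prop, IsBimoduleGraph P W →
    ∃ c : F, ∀ a b, W a b → c • ι a = ι b

namespace IsMartindaleExtension

variable {F : Type*} [CommRing F] {Q : Type*} [Ring Q] [Algebra F Q]
    {P : TwoSidedIdeal R} {ι : R →+* Q} (h : IsMartindaleExtension F P ι)
include h

theorem eq_iff (r s : R) : ι r = ι s ↔ r - s ∈ P := by
  rw [← h.eq_zero_iff, map_sub, sub_eq_zero]

theorem exists_mul_ne_zero {q : Q} (hq : q ≠ 0) {J : TwoSidedIdeal R} (hJ : ¬J ≤ P) :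
    ∃ x ∈ J, q * ι x ≠ 0 := by
  by_contra! h'
  exact hq (h.eq_zero q J hJ h')

theorem exists_mul_eq {q : Q} (hq : q ≠ 0) : ∃ x a, q * ι x = ι a ∧ a ∉ P := by
  obtain ⟨J, hJ, h'⟩ := h.exists_ideal q
  obtain ⟨x, hx, hx'⟩ := h.exists_mul_ne_zero hq hJ
  obtain ⟨a, ha⟩ := h' x hx
  exact ⟨x, a, ha, fun haP => hx' (by rw [ha, (h.eq_zero_iff a).2 haP])⟩

theorem mul_mul_ne_zero {p q : Q} (hp : p ≠ 0) (hq : q ≠ 0) : ∃ r, p * ι r * q ≠ 0 := by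
  obtain ⟨x, a, hx, ha⟩ := h.exists_mul_eq hp
  obtain ⟨y, b, hy, hb⟩ := h.exists_mul_eq hq
  obtain ⟨r, hr⟩ := h.isPrime.exists_mul_mul_notMem ha hb
  refine ⟨x * r, fun h0 => hr ((h.eq_zero_iff _).1 ?_)⟩
  rw [map_mul, map_mul, ← hx, ← hy, ← mul_assoc, mul_assoc p, ← map_mul, h0, zero_mul]

/-- Elements of the extended centroid are fractions. -/
theorem exists_smul_eq (c : F) : ∃ a b, c • ι a = ι b ∧ a ∉ P := by
  obtain ⟨J, hJ, h'⟩ := h.exists_ideal (algebraMap F Q c)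
  obtain ⟨a, ha, haP⟩ := Set.not_subset.1 hJ
  obtain ⟨b, hb⟩ := h' a ha
  exact ⟨a, b, by rw [Algebra.smul_def, hb], haP⟩

/-- Multiplication by a nonzero element of the extended centroid is injective on `R/P`. -/
theorem mem_of_smul_eq {c : F} (hc : algebraMap F Q c ≠ 0) {a b : R} (hab : c • ι a = ι b)
    (hb : b ∈ P) : a ∈ P := by
  by_contra ha
  obtain ⟨r, hr⟩ := h.mul_mul_ne_zero hc (mt (h.eq_zero_iff a).1 ha)
  rw [Algebra.commutes, mul_assoc, ← Algebra.smul_def, hab, (h.eq_zero_iff b).2 hb,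
    mul_zero] at hr
  exact hr rfl

theorem isBimoduleGraph_smul {c : F} (hc : algebraMap F Q c ≠ 0) :
    IsBimoduleGraph P fun b a => c • ι a = ι b where
  add {a b a' b'} hab hab' := by rw [map_add, smul_add, hab, hab', map_add]
  mul_left r hab := by rw [map_mul, ← mul_smul_comm, hab, map_mul]
  mul_right r hab := by rw [map_mul, ← smul_mul_assoc, hab, map_mul]
  mem {a b} hab ha := h.mem_of_smul_eq hc hab ha
  exists_notMem := by
    obtain ⟨a, b, hab, ha⟩ := h.exists_smul_eq c
    exact ⟨b, a, hab, fun hb => ha (h.mem_of_smul_eq hc hab hb)⟩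

/-- The extended centroid of a prime ring is a field. -/
theorem isField (hF : Function.Injective (algebraMap F Q)) : IsField F where
  exists_pair_ne := ⟨0, 1, fun h01 => h.isPrime.one_notMem <| (h.eq_zero_iff 1).1 <| by
    rw [map_one, ← map_one (algebraMap F Q), ← h01, map_zero]⟩
  mul_comm := mul_comm
  mul_inv_cancel {c} hc := by
    have hc' : algebraMap F Q c ≠ 0 := by rwa [Ne, map_eq_zero_iff _ hF]
    obtain ⟨d, hd⟩ := h.exists_scalar _ (h.isBimoduleGraph_smul hc')
    obtain ⟨J, hJ, h'⟩ := h.exists_ideal (algebraMap F Q c)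
    refine ⟨d, hF (sub_eq_zero.1 (h.eq_zero _ J hJ fun x hx => ?_))⟩
    obtain ⟨b, hb⟩ := h' x hx
    have := hd b x (by rw [Algebra.smul_def, hb])
    rw [sub_mul, ← Algebra.smul_def, mul_comm c d, mul_smul, Algebra.smul_def c, hb, this,
      map_one, one_mul, sub_self]

end IsMartindaleExtension

end Extension

/-! ### The Martindale ring of quotients of a prime residue ring -/

section Martindale

variable {R : Type*} [Ring R]

/-- The canonical homomorphism `R → R/P → Q_r(R/P)`. -/
def toMartindale (P : TwoSidedIdeal R) : R →+* MartindaleQuotient (ResidueRing P) :=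
  (MartindaleQuotient.ofRing (ResidueRing P)).comp P.ringCon.mk'

theorem coe_eq_zero_iff {P : TwoSidedIdeal R} (r : R) : (r : ResidueRing P) = 0 ↔ r ∈ P := by
  rw [TwoSidedIdeal.mem_iff]
  exact RingCon.eq P.ringCon

theorem isDense_of_exists_notMem {P : TwoSidedIdeal R} (hP : IsPrimeIdeal P)
    {J : TwoSidedIdeal (ResidueRing P)} (hJ : ∃ a : R, a ∉ P ∧ (a : ResidueRing P) ∈ J) :
    IsDense J := by
  rintro ⟨r⟩ hr
  obtain ⟨a, ha, haJ⟩ := hJ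
  refine (coe_eq_zero_iff r).2 ((hP.mem_or_mem (b := a) fun s => ?_).resolve_right ha)
  rw [← coe_eq_zero_iff, mul_assoc]
  exact hr _ (J.mul_mem_left (s : ResidueRing P) _ haJ)

theorem IsDense.exists_notMem {P : TwoSidedIdeal R} (hP : IsPrimeIdeal P)
    {J : TwoSidedIdeal (ResidueRing P)} (hJ : IsDense J) :
    ∃ a : R, a ∉ P ∧ (a : ResidueRing P) ∈ J := by
  by_contra! h
  refine hP.one_notMem ((coe_eq_zero_iff 1).1 (hJ _ ?_))
  rintro ⟨x⟩ hx
  have : x ∈ P := by_contra fun hx' => h x hx' hx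
  exact (coe_eq_zero_iff _).2 (P.mul_mem_left 1 x this)

theorem MartindaleQuotient.mk_eq_iff {S : Type*} [Ring S] {f g : PartialMap S} :
    mk f = mk g ↔ PartialMap.Equivalent f g := Quotient.eq

theorem MartindaleQuotient.ofRing_eq_zero_iff {S : Type*} [Ring S] (s : S) :
    ofRing S s = 0 ↔ s = 0 := by
  refine ⟨fun h => ?_, fun h => by rw [h, map_zero]⟩
  obtain ⟨J, hJ, h1, h2, h⟩ := mk_eq_iff.1 h
  exact hJ s fun x hx => (h x hx (h1 hx) (h2 hx)).trans (zero_mul x)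

theorem MartindaleQuotient.mk_mul_ofRing {S : Type*} [Ring S] (f : PartialMap S) {s : S}
    (hs : s ∈ f.dom) : mk f * ofRing S s = ofRing S (f.map ⟨s, hs⟩) :=
  mk_eq fun _ _ _ => f.map_mul_right hs _ _

theorem MartindaleQuotient.eq_zero_of_forall {S : Type*} [Ring S] (q : MartindaleQuotient S)
    {J : TwoSidedIdeal S} (hJ : IsDense J) (h : ∀ s ∈ J, q * ofRing S s = 0) : q = 0 := by
  induction q using ind with | _ f
  refine mk_eq_iff.2 ⟨f.dom ⊓ J, f.isDense.inf hJ, inf_le_left, fun x _ => TwoSidedIdeal.mem_top S,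
    fun x hx hf _ => ?_⟩
  have := h x ((TwoSidedIdeal.mem_inf S).1 hx).2
  rw [mk_mul_ofRing f hf, ofRing_eq_zero_iff] at this
  rw [this]
  exact (zero_mul x).symm

theorem MartindaleQuotient.commute_of_bimodule {S : Type*} [Ring S] (f : PartialMap S)
    (hf : ∀ s x (hx : x ∈ f.dom), f.map ⟨s * x, f.dom.mul_mem_left s x hx⟩ = s * f.map ⟨x, hx⟩)
    (q : MartindaleQuotient S) : q * mk f = mk f * q := by
  induction q using ind with | _ g
  refine mk_eq_iff.2 ⟨idealMul (f.dom ⊓ g.dom) (f.dom ⊓ g.dom),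
    (f.isDense.inf g.isDense).idealMul (f.isDense.inf g.isDense),
    PartialMap.idealMul_mono inf_le_left inf_le_right,
    PartialMap.idealMul_mono inf_le_right inf_le_left, fun x hx => ?_⟩
  intro h1 h2
  have key : ∃ h1 h2, (PartialMap.comp g f).map ⟨x, h1⟩ = (PartialMap.comp f g).map ⟨x, h2⟩ := by
    refine idealMul_induction (C := fun x => ∃ h1 h2,
      (PartialMap.comp g f).map ⟨x, h1⟩ = (PartialMap.comp f g).map ⟨x, h2⟩)
      (fun x hx y hy => ?_) (fun x y ⟨h1, h2, h⟩ ⟨h1', h2', h'⟩ => ?_) hx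
    · have hx' := (TwoSidedIdeal.mem_inf S).1 hx
      have hy' := (TwoSidedIdeal.mem_inf S).1 hy
      have h1 : x * y ∈ (PartialMap.comp g f).dom := mul_mem_idealMul hx'.1 hy'.2
      have h2 : x * y ∈ (PartialMap.comp f g).dom := mul_mem_idealMul hx'.2 hy'.1
      refine ⟨h1, h2, ?_⟩
      rw [PartialMap.eval_comp, PartialMap.eval_comp]
      simp only [hf x y hy'.1, g.map_mul_right hx'.2 y]
      rw [g.map_mul_right hx'.2, hf]
    · refine ⟨TwoSidedIdeal.add_mem _ h1 h1', TwoSidedIdeal.add_mem _ h2 h2', ?_⟩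
      rw [PartialMap.map_add_mk _ h1 h1', PartialMap.map_add_mk _ h2 h2', h, h']
  exact key.2.2

variable {k : Type*} [Field k] [Algebra k R]

variable (k) in
/-- `Q_r(S)` is an algebra over its center. -/
instance centroidAlgebra (S : Type*) [Ring S] [Algebra k S] :
    Algebra (ExtendedCentroid k S) (MartindaleQuotient S) where
  toSMul := inferInstance
  algebraMap := (ExtendedCentroid k S).val.toRingHom
  commutes' c q := (Subalgebra.mem_center_iff.1 c.2 q).symm
  smul_def' _ _ := rfl

theorem centroid_smul_def {S : Type*} [Ring S] [Algebra k S] (c : ExtendedCentroid k S)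
    (q : MartindaleQuotient S) : c • q = c.1 * q := rfl

instance {S : Type*} [Ring S] [Algebra k S] :
    IsScalarTower k (ExtendedCentroid k S) (MartindaleQuotient S) :=
  IsScalarTower.of_algebraMap_eq fun _ => rfl

instance {S : Type*} [Ring S] [Algebra k S] :
    FaithfulSMul (ExtendedCentroid k S) (MartindaleQuotient S) :=
  (faithfulSMul_iff_algebraMap_injective _ _).2 Subtype.val_injective

/-- The image of `W` in `R/P × R/P` is the graph of a partial map that commutes with left and right
multiplications. -/
theorem exists_partialMap {P : TwoSidedIdeal R} (hP : IsPrimeIdeal P) {W : R → R → Prop}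
    (hW : IsBimoduleGraph P W) : ∃ f : PartialMap (ResidueRing P),
      (∀ s x (hx : x ∈ f.dom), f.map ⟨s * x, f.dom.mul_mem_left s x hx⟩ = s * f.map ⟨x, hx⟩) ∧
      ∀ a b, W a b → ∃ ha : (a : ResidueRing P) ∈ f.dom, f.map ⟨a, ha⟩ = b := by
  let J : TwoSidedIdeal (ResidueRing P) := .mk' {s | ∃ a b, W a b ∧ (a : ResidueRing P) = s}
    ⟨0, 0, hW.zero, rfl⟩
    (by rintro _ _ ⟨a, b, h, rfl⟩ ⟨a', b', h', rfl⟩; exact ⟨_, _, hW.add h h', rfl⟩)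
    (by rintro _ ⟨a, b, h, rfl⟩; exact ⟨_, _, hW.neg h, rfl⟩)
    (by rintro ⟨r⟩ _ ⟨a, b, h, rfl⟩; exact ⟨_, _, hW.mul_left r h, rfl⟩)
    (by rintro _ ⟨r⟩ ⟨a, b, h, rfl⟩; exact ⟨_, _, hW.mul_right r h, rfl⟩)
  have hJ : ∀ s, s ∈ J ↔ ∃ a b, W a b ∧ (a : ResidueRing P) = s := fun x => by
    simp only [J, TwoSidedIdeal.mem_mk', Set.mem_ofPred_eq]
  choose u v huv hu using fun s : J => (hJ s.1).1 s.2
  have key : ∀ a b (h : W a b) (ha : (a : ResidueRing P) ∈ J),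
      (v ⟨a, ha⟩ : ResidueRing P) = b := fun a b h ha => by
    refine sub_eq_zero.1 ((coe_eq_zero_iff (v ⟨a, ha⟩ - b)).2 (hW.mem (hW.sub (huv _) h) ?_))
    exact (coe_eq_zero_iff (u ⟨a, ha⟩ - a)).1 (sub_eq_zero.2 (hu ⟨a, ha⟩))
  obtain ⟨a, b, hab, haP⟩ := hW.exists_notMem
  refine ⟨PartialMap.mk' J (isDense_of_exists_notMem hP ⟨a, haP, (hJ _).2 ⟨a, b, hab, rfl⟩⟩)
    (fun s => (v s : ResidueRing P)) ?_ ?_, ?_, ?_⟩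
  · intro x y hx hy
    obtain ⟨a, b, h, rfl⟩ := (hJ _).1 hx
    obtain ⟨a', b', h', rfl⟩ := (hJ _).1 hy
    rw [key _ _ h, key _ _ h']
    exact key _ _ (hW.add h h') (J.add_mem hx hy)
  · rintro x ⟨r⟩ hx
    obtain ⟨a, b, h, rfl⟩ := (hJ _).1 hx
    rw [key _ _ h]
    exact key _ _ (hW.mul_right r h) (J.mul_mem_right _ (r : ResidueRing P) hx)
  · rintro ⟨r⟩ x hx
    obtain ⟨a, b, h, rfl⟩ := (hJ _).1 hx
    refine (key _ _ (hW.mul_left r h) (J.mul_mem_left (r : ResidueRing P) _ hx)).trans ?_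
    exact congrArg ((r : ResidueRing P) * ·) (key _ _ h hx).symm
  · exact fun a b h => ⟨(hJ _).2 ⟨a, b, h, rfl⟩, key _ _ h _⟩

variable (k) in
theorem isMartindaleExtension_toMartindale {P : TwoSidedIdeal R} (hP : IsPrimeIdeal P) :
    IsMartindaleExtension (ExtendedCentroid k (ResidueRing P)) P (toMartindale P) where
  isPrime := hP
  eq_zero_iff r := (MartindaleQuotient.ofRing_eq_zero_iff _).trans (coe_eq_zero_iff r)
  exists_ideal q := by
    induction q using MartindaleQuotient.ind with | _ f
    refine ⟨f.dom.comap P.ringCon.mk', fun hJ => ?_, fun x hx => ?_⟩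
    · obtain ⟨a, ha, ha'⟩ := f.isDense.exists_notMem hP
      exact ha (hJ ((TwoSidedIdeal.mem_comap _).2 ha'))
    · obtain ⟨b, hb⟩ := P.ringCon.mk'_surjective (f.map ⟨x, (TwoSidedIdeal.mem_comap _).1 hx⟩)
      exact ⟨b, (MartindaleQuotient.mk_mul_ofRing f ((TwoSidedIdeal.mem_comap _).1 hx)).trans
        (congrArg _ hb.symm)⟩
  eq_zero q J hJ h := by
    let J' : TwoSidedIdeal (ResidueRing P) := .mk' {s | ∃ a ∈ J, (a : ResidueRing P) = s}
      ⟨0, J.zero_mem, rfl⟩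
      (by rintro _ _ ⟨a, h, rfl⟩ ⟨a', h', rfl⟩; exact ⟨_, J.add_mem h h', rfl⟩)
      (by rintro _ ⟨a, h, rfl⟩; exact ⟨_, J.neg_mem h, rfl⟩)
      (by rintro ⟨r⟩ _ ⟨a, h, rfl⟩; exact ⟨_, J.mul_mem_left r _ h, rfl⟩)
      (by rintro _ ⟨r⟩ ⟨a, h, rfl⟩; exact ⟨_, J.mul_mem_right _ r h, rfl⟩)
    have hJ' : ∀ s, s ∈ J' ↔ ∃ a ∈ J, (a : ResidueRing P) = s := fun x => by
      simp only [J', TwoSidedIdeal.mem_mk', Set.mem_ofPred_eq]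
    obtain ⟨a, ha, haP⟩ := Set.not_subset.1 hJ
    refine MartindaleQuotient.eq_zero_of_forall q
      (isDense_of_exists_notMem hP ⟨a, haP, (hJ' _).2 ⟨a, ha, rfl⟩⟩) fun s hs => ?_
    obtain ⟨b, hb, rfl⟩ := (hJ' s).1 hs
    exact h b hb
  exists_scalar W hW := by
    obtain ⟨f, hf, hfW⟩ := exists_partialMap hP hW
    refine ⟨⟨MartindaleQuotient.mk f, Subalgebra.mem_center_iff.2
      fun q => MartindaleQuotient.commute_of_bimodule f hf q⟩, fun a b hab => ?_⟩
    obtain ⟨ha, hab⟩ := hfW a b hab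
    exact (MartindaleQuotient.mk_mul_ofRing f ha).trans (congrArg _ hab)

variable (k) in
theorem toMartindale_algebraMap_mul (P : TwoSidedIdeal R) (l : k) (a : R) :
    toMartindale P (algebraMap k R l * a) =
      algebraMap k (ExtendedCentroid k (ResidueRing P)) l • toMartindale P a :=
  map_mul (toMartindale P) _ _

/-- For a rational ideal `P`, every bimodule map from a nonzero ideal of `R/P` to `R/P` is
multiplication by a scalar. -/
theorem IsRational.exists_scalar {P : TwoSidedIdeal R} (hP : IsRational k P) {W : R → R → Prop}
    (hW : IsBimoduleGraph P W) : ∃ l : k, ∀ a b, W a b → b - l • a ∈ P := by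
  have h := isMartindaleExtension_toMartindale k hP.isPrime
  obtain ⟨c, hc⟩ := h.exists_scalar W hW
  obtain ⟨l, hl⟩ := hP.eq_base c
  refine ⟨l, fun a b hab => ?_⟩
  rw [← h.eq_iff, Algebra.smul_def, toMartindale_algebraMap_mul, hl, hc a b hab]

theorem isRational_of_exists_scalar {P : TwoSidedIdeal R} (hP : IsPrimeIdeal P)
    (hW : ∀ W, IsBimoduleGraph P W → ∃ l : k, ∀ a b, W a b → b - l • a ∈ P) :
    IsRational k P where
  isPrime := hP
  eq_base c := by
    have h := isMartindaleExtension_toMartindale k hP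
    obtain ⟨l, hl⟩ := hW (fun a b => c • toMartindale P a = toMartindale P b)
      { add := fun hab hab' => by rw [map_add, smul_add, hab, hab', map_add]
        mul_left := fun r hab => by rw [map_mul, ← mul_smul_comm, hab, map_mul]
        mul_right := fun r hab => by rw [map_mul, ← smul_mul_assoc, hab, map_mul]
        mem := fun {a b} hab ha => by
          rw [← h.eq_zero_iff, ← hab, (h.eq_zero_iff a).2 ha, smul_zero]
        exists_notMem := by
          obtain ⟨a, b, hab, ha⟩ := h.exists_smul_eq c
          exact ⟨a, b, hab, ha⟩ }
    obtain ⟨J, hJ, h'⟩ := h.exists_ideal c.1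
    refine ⟨l, Subtype.ext (sub_eq_zero.1 (h.eq_zero _ J hJ fun x hx => ?_))⟩
    obtain ⟨b, hb⟩ := h' x hx
    have := (h.eq_iff _ _).2 (hl x b hb)
    rw [sub_mul, hb, this, Algebra.smul_def, toMartindale_algebraMap_mul, centroid_smul_def,
      sub_self]

end Martindale

/-! ### Density of the multiplication ring -/

section Density

open scoped TensorProduct

variable {R : Type*} [Ring R] {F : Type*} [Field F] {Q : Type*} [Ring Q] [Algebra F Q]

variable (F) in
/-- The algebra of endomorphisms of `Q` generated over `F` by the left and right multiplications
by elements of `R`. -/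
def multiplicationAlgebra (ι : R →+* Q) : Subalgebra F (Module.End F Q) :=
  Algebra.adjoin F (Set.range (fun r => LinearMap.mulLeft F (ι r)) ∪
    Set.range fun r => LinearMap.mulRight F (ι r))

theorem mulLeft_mem (ι : R →+* Q) (r : R) :
    LinearMap.mulLeft F (ι r) ∈ multiplicationAlgebra F ι :=
  Algebra.subset_adjoin (Or.inl ⟨r, rfl⟩)

theorem mulRight_mem (ι : R →+* Q) (r : R) :
    LinearMap.mulRight F (ι r) ∈ multiplicationAlgebra F ι :=
  Algebra.subset_adjoin (Or.inr ⟨r, rfl⟩)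

theorem tmul_ne_zero {K : Type*} [Field K] [Algebra F K] {κ : K} (hκ : κ ≠ 0) {q : Q}
    (hq : q ≠ 0) : (κ ⊗ₜ q : K ⊗[F] Q) ≠ 0 := fun h => hq <| by
  rw [← Module.FaithfullyFlat.one_tmul_eq_zero_iff F Q (A := K)]
  simpa [TensorProduct.smul_tmul', hκ] using congrArg (κ⁻¹ • ·) h

namespace IsMartindaleExtension

variable {P : TwoSidedIdeal R} {ι : R →+* Q} (h : IsMartindaleExtension F P ι)
include h

/-- Martindale's lemma: the double annihilator of a finite subset `s` of `Q` with respect to the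
multiplication algebra is the `F`-span of `s`. -/
theorem mem_span_of_forall (s : Finset Q) (q : Q)
    (hq : ∀ β ∈ multiplicationAlgebra F ι, (∀ p ∈ s, β p = 0) → β q = 0) :
    q ∈ Submodule.span F (s : Set Q) := by
  classical
  induction s using Finset.induction_on generalizing q with
  | empty =>
    simpa using hq 1 (one_mem _) (by simp)
  | insert p s hps ih =>
    by_cases hL : ∀ β ∈ multiplicationAlgebra F ι, (∀ p ∈ s, β p = 0) → β p = 0
    · refine Submodule.span_mono (by simp) (ih q fun β hβ hs => hq β hβ fun p' hp' => ?_)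
      rcases Finset.mem_insert.1 hp' with rfl | hp'
      · exact hL β hβ hs
      · exact hs p' hp'
    -- The bimodule map `β p ↦ β q`, for `β` annihilating `s`, is multiplication by a scalar `c`.
    push Not at hL
    obtain ⟨β₀, hβ₀, hs₀, hp₀⟩ := hL
    have hfrac : ∀ u v : Q, ∃ J : TwoSidedIdeal R, ¬J ≤ P ∧ ∀ x ∈ J,
        (∃ a, u * ι x = ι a) ∧ ∃ b, v * ι x = ι b := fun u v => by
      obtain ⟨J, hJ, hu⟩ := h.exists_ideal u
      obtain ⟨J', hJ', hv⟩ := h.exists_ideal v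
      exact ⟨J ⊓ J', h.isPrime.not_inf_le hJ hJ', fun x hx =>
        ⟨hu x ((TwoSidedIdeal.mem_inf R).1 hx).1, hv x ((TwoSidedIdeal.mem_inf R).1 hx).2⟩⟩
    let W : R → R → Prop := fun a b => ∃ β ∈ multiplicationAlgebra F ι,
      (∀ p ∈ s, β p = 0) ∧ β p = ι a ∧ β q = ι b
    have hW : IsBimoduleGraph P W :=
      { add := fun ⟨β, hβ, hs, ha, hb⟩ ⟨β', hβ', hs', ha', hb'⟩ =>
          ⟨β + β', add_mem hβ hβ', fun p hp => by simp [hs p hp, hs' p hp],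
            by simp [ha, ha'], by simp [hb, hb']⟩
        mul_left := fun r ⟨β, hβ, hs, ha, hb⟩ =>
          ⟨LinearMap.mulLeft F (ι r) * β, mul_mem (mulLeft_mem ι r) hβ,
            fun p hp => by simp [hs p hp], by simp [ha], by simp [hb]⟩
        mul_right := fun r ⟨β, hβ, hs, ha, hb⟩ =>
          ⟨LinearMap.mulRight F (ι r) * β, mul_mem (mulRight_mem ι r) hβ,
            fun p hp => by simp [hs p hp], by simp [ha], by simp [hb]⟩
        mem := fun {a b} ⟨β, hβ, hs, ha, hb⟩ haP => by
          rw [← h.eq_zero_iff, ← hb]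
          refine hq β hβ fun p' hp' => ?_
          rcases Finset.mem_insert.1 hp' with rfl | hp'
          · rw [ha, (h.eq_zero_iff a).2 haP]
          · exact hs p' hp'
        exists_notMem := by
          obtain ⟨J, hJ, hJ'⟩ := hfrac (β₀ p) (β₀ q)
          obtain ⟨x, hx, hx'⟩ := h.exists_mul_ne_zero hp₀ hJ
          obtain ⟨⟨a, ha⟩, b, hb⟩ := hJ' x hx
          refine ⟨a, b, ⟨LinearMap.mulRight F (ι x) * β₀, mul_mem (mulRight_mem ι x) hβ₀,
            fun p hp => by simp [hs₀ p hp], by simp [ha], by simp [hb]⟩, fun haP => hx' ?_⟩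
          rw [ha, (h.eq_zero_iff a).2 haP] }
    obtain ⟨c, hc⟩ := h.exists_scalar W hW
    have : q - c • p ∈ Submodule.span F (s : Set Q) := by
      refine ih _ fun β hβ hs => ?_
      obtain ⟨J, hJ, hJ'⟩ := hfrac (β p) (β q)
      refine h.eq_zero _ J hJ fun x hx => ?_
      obtain ⟨⟨a, ha⟩, b, hb⟩ := hJ' x hx
      have := hc a b ⟨LinearMap.mulRight F (ι x) * β, mul_mem (mulRight_mem ι x) hβ,
            fun p hp => by simp [hs p hp], by simp [ha], by simp [hb]⟩
      rw [map_sub, map_smul, sub_mul, smul_mul_assoc, ha, hb, this, sub_self]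
    rw [← sub_add_cancel q (c • p)]
    refine add_mem (Submodule.span_mono (by simp) this)
      (Submodule.smul_mem _ _ (Submodule.subset_span (by simp)))

variable {K : Type*} [Field K] [Algebra F K]

/-- A `K`-subspace of `(K ⊗ Q)²` that is stable under left and right multiplication by `R` and
contains `(t, t')` with `t ≠ 0` contains some `(1 ⊗ a, κ ⊗ a)` with `0 ≠ a ∈ R/P`. -/
theorem exists_mem_of_ne_zero {N : Submodule K ((K ⊗[F] Q) × (K ⊗[F] Q))}
    (hl : ∀ r, ∀ z ∈ N, ((1 ⊗ₜ ι r) * z.1, (1 ⊗ₜ ι r) * z.2) ∈ N)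
    (hr : ∀ r, ∀ z ∈ N, (z.1 * (1 ⊗ₜ ι r), z.2 * (1 ⊗ₜ ι r)) ∈ N)
    {t t' : K ⊗[F] Q} (ht : (t, t') ∈ N) (ht0 : t ≠ 0) :
    ∃ a ∉ P, ∃ κ : K, ((1 ⊗ₜ ι a, κ ⊗ₜ ι a) : (K ⊗[F] Q) × (K ⊗[F] Q)) ∈ N := by
  classical
  have hN : ∀ β ∈ multiplicationAlgebra F ι, ∀ z ∈ N,
      (LinearMap.baseChange K β z.1, LinearMap.baseChange K β z.2) ∈ N := by
    intro β hβ
    induction hβ using Algebra.adjoin_induction with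
    | mem β hβ =>
      rintro z hz
      rcases hβ with ⟨r, rfl⟩ | ⟨r, rfl⟩
      · have : ∀ t : K ⊗[F] Q,
            LinearMap.baseChange K (LinearMap.mulLeft F (ι r)) t = (1 ⊗ₜ ι r) * t := fun t => by
          induction t with
          | zero => simp
          | tmul x y => simp
          | add x y hx hy => rw [map_add, hx, hy, mul_add]
        rw [this, this]
        exact hl r z hz
      · have : ∀ t : K ⊗[F] Q,
            LinearMap.baseChange K (LinearMap.mulRight F (ι r)) t = t * (1 ⊗ₜ ι r) := fun t => by
          induction t with
          | zero => simp
          | tmul x y => simp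
          | add x y hx hy => rw [map_add, hx, hy, add_mul]
        rw [this, this]
        exact hr r z hz
    | algebraMap c =>
      intro z hz
      have : ∀ t : K ⊗[F] Q, LinearMap.baseChange K (algebraMap F (Module.End F Q) c) t =
          algebraMap F K c • t := fun t => by
        induction t with
        | zero => simp
        | tmul x y => simp [TensorProduct.smul_tmul']
        | add x y hx hy => rw [map_add, hx, hy, smul_add]
      rw [this, this]
      exact N.smul_mem (algebraMap F K c) hz
    | add β β' _ _ h1 h2 =>
      intro z hz
      rw [LinearMap.baseChange_add]
      exact N.add_mem (h1 z hz) (h2 z hz)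
    | mul β β' _ _ h1 h2 =>
      intro z hz
      rw [LinearMap.baseChange_mul]
      exact h1 _ (h2 z hz)
  let b := Module.Basis.ofVectorSpace F Q
  let B := b.baseChange K
  obtain ⟨i, hi⟩ : ∃ i, B.repr t i ≠ 0 := by
    by_contra! h0
    exact ht0 (B.repr.map_eq_zero_iff.1 (Finsupp.ext h0))
  let s := ((B.repr t).support ∪ (B.repr t').support).erase i
  obtain ⟨β, hβ, hs, hβi⟩ : ∃ β ∈ multiplicationAlgebra F ι,
      (∀ p ∈ s.image b, β p = 0) ∧ β (b i) ≠ 0 := by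
    by_contra! h0
    have := h.mem_span_of_forall (s.image b) (b i) h0
    rw [Finset.coe_image] at this
    exact b.linearIndependent.notMem_span_image (by simp [s]) this
  -- `β` kills all basis vectors occurring in `t` and `t'` except the `i`-th one.
  have hβt : ∀ t₁ : K ⊗[F] Q, (B.repr t₁).support.erase i ⊆ s →
      LinearMap.baseChange K β t₁ = B.repr t₁ i ⊗ₜ β (b i) := fun t₁ ht₁ => by
    conv_lhs => rw [← B.linearCombination_repr t₁]
    rw [Finsupp.linearCombination_apply, Finsupp.sum, map_sum, Finset.sum_eq_single i]
    · simp [B, TensorProduct.smul_tmul']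
    · intro j hj hji
      have := hs (b j) (Finset.mem_image_of_mem b (ht₁ (Finset.mem_erase.2 ⟨hji, hj⟩)))
      simp [B, this]
    · intro hi'
      rw [Finsupp.notMem_support_iff.1 hi', zero_smul, map_zero]
  obtain ⟨x, a, hx, ha⟩ := h.exists_mul_eq hβi
  have := N.smul_mem (B.repr t i)⁻¹ (hr x _ (hN β hβ _ ht))
  refine ⟨a, ha, (B.repr t i)⁻¹ * B.repr t' i, ?_⟩
  rw [hβt t (Finset.erase_subset_erase _ Finset.subset_union_left),
    hβt t' (Finset.erase_subset_erase _ Finset.subset_union_right)] at this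
  simpa [hx, TensorProduct.smul_tmul', hi] using this

/-- The ring `K ⊗ Q` is prime, even when testing with elements of `R` only. -/
theorem eq_zero_or_eq_zero_of_mul {t t' : K ⊗[F] Q} (ht : ∀ r, t * (1 ⊗ₜ ι r) * t' = 0) :
    t = 0 ∨ t' = 0 := by
  by_contra! h0
  let N : Submodule K ((K ⊗[F] Q) × (K ⊗[F] Q)) :=
    { carrier := {z | ∀ r, z.1 * (1 ⊗ₜ ι r) * t' = 0}
      zero_mem' := by simp
      add_mem' := fun {x y} hx hy r => by
        rw [Prod.fst_add, add_mul, add_mul, hx r, hy r, add_zero]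
      smul_mem' := fun κ x hx r => by
        rw [Prod.smul_fst, smul_mul_assoc, smul_mul_assoc, hx r, smul_zero] }
  obtain ⟨a, ha, _, haN⟩ := h.exists_mem_of_ne_zero (N := N) (t := t) (t' := t)
    (fun r z hz s => by rw [mul_assoc, mul_assoc, ← mul_assoc z.1, hz s, mul_zero])
    (fun r z hz s => by
      rw [mul_assoc z.1, Algebra.TensorProduct.tmul_mul_tmul, one_mul, ← map_mul]
      exact hz _) ht h0.1
  replace haN : ∀ r, (1 ⊗ₜ ι a : K ⊗[F] Q) * (1 ⊗ₜ ι r) * t' = 0 := haN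
  let N' : Submodule K ((K ⊗[F] Q) × (K ⊗[F] Q)) :=
    { carrier := {z | ∀ r, (1 ⊗ₜ ι a : K ⊗[F] Q) * (1 ⊗ₜ ι r) * z.1 = 0}
      zero_mem' := by simp
      add_mem' := fun {x y} hx hy r => by
        rw [Prod.fst_add, mul_add, hx r, hy r, add_zero]
      smul_mem' := fun κ x hx r => by
        rw [Prod.smul_fst, mul_smul_comm, hx r, smul_zero] }
  obtain ⟨b, hb, _, hbN⟩ := h.exists_mem_of_ne_zero (N := N') (t := t') (t' := t')
    (fun r z hz s => by
      rw [← mul_assoc, mul_assoc (1 ⊗ₜ ι a), Algebra.TensorProduct.tmul_mul_tmul, one_mul,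
        ← map_mul]
      exact hz _)
    (fun r z hz s => by rw [← mul_assoc, hz s, zero_mul]) haN h0.2
  obtain ⟨r, hr⟩ := h.mul_mul_ne_zero (mt (h.eq_zero_iff a).1 ha) (mt (h.eq_zero_iff b).1 hb)
  have := hbN r
  simp only [Algebra.TensorProduct.tmul_mul_tmul, one_mul] at this
  exact tmul_ne_zero one_ne_zero hr this

/-- If `t r t' = t' r t` for all `r ∈ R`, then `t` and `t'` are proportional over `K`. -/
theorem exists_smul_eq_of_mul_comm {t t' : K ⊗[F] Q} (ht0 : t ≠ 0)
    (ht : ∀ r, t' * (1 ⊗ₜ ι r) * t = t * (1 ⊗ₜ ι r) * t') : ∃ κ : K, t' = κ • t := by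
  let N : Submodule K ((K ⊗[F] Q) × (K ⊗[F] Q)) :=
    { carrier := {z | ∀ r, z.2 * (1 ⊗ₜ ι r) * t = z.1 * (1 ⊗ₜ ι r) * t'}
      zero_mem' := by simp
      add_mem' := fun {x y} hx hy r => by
        rw [Prod.fst_add, Prod.snd_add, add_mul, add_mul, hx r, hy r, add_mul, add_mul]
      smul_mem' := fun κ x hx r => by
        rw [Prod.smul_fst, Prod.smul_snd, smul_mul_assoc, smul_mul_assoc, hx r, smul_mul_assoc,
          smul_mul_assoc] }
  obtain ⟨a, ha, κ, haN⟩ := h.exists_mem_of_ne_zero (N := N) (t := t) (t' := t')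
    (fun r z hz s => by
      simpa only [mul_assoc] using congrArg ((1 ⊗ₜ ι r : K ⊗[F] Q) * ·) (hz s))
    (fun r z hz s => by
      rw [mul_assoc z.1, mul_assoc z.2, Algebra.TensorProduct.tmul_mul_tmul, one_mul, ← map_mul]
      exact hz _) ht ht0
  replace haN : ∀ r, (κ ⊗ₜ ι a : K ⊗[F] Q) * (1 ⊗ₜ ι r) * t = (1 ⊗ₜ ι a) * (1 ⊗ₜ ι r) * t' := haN
  refine ⟨κ, sub_eq_zero.1 ((h.eq_zero_or_eq_zero_of_mul (t := 1 ⊗ₜ ι a) fun r => ?_).resolve_left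
    (tmul_ne_zero one_ne_zero (mt (h.eq_zero_iff a).1 ha)))⟩
  rw [mul_sub, ← haN, mul_smul_comm, ← smul_mul_assoc, ← smul_mul_assoc, TensorProduct.smul_tmul',
    smul_eq_mul, mul_one, sub_self]

end IsMartindaleExtension

end Density

/-! ### Connected algebraic groups are irreducible -/

section Group

variable {k : Type*} [Field k] {G : Type*} [Group G] [AffineAlgebraicGroup k G]

variable (k) in
/-- Evaluation of regular functions at a point of `G`. -/
def evalPoint (x : G) : regularFunctions k G →ₐ[k] k :=
  (Pi.evalAlgHom k (fun _ : G => k) x).comp (regularFunctions k G).val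

variable (k G) in
theorem noetherianSpace_zariskiTopology :
    @TopologicalSpace.NoetherianSpace G (zariskiTopology k G) := by
  let _ := zariskiTopology k G
  have : Algebra.FiniteType k (regularFunctions k G) :=
    (Subalgebra.fg_iff_finiteType _).1 AffineAlgebraicGroup.fg
  have := Algebra.FiniteType.isNoetherianRing k (regularFunctions k G)
  let φ : G → PrimeSpectrum (regularFunctions k G) := fun x =>
    ⟨RingHom.ker (evalPoint k x), RingHom.ker_isPrime _⟩
  have hφ : Topology.IsInducing φ := by
    refine ⟨?_⟩
    rw [PrimeSpectrum.isTopologicalBasis_basic_opens.eq_generateFrom, induced_generateFrom_eq]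
    refine congrArg TopologicalSpace.generateFrom (Set.ext fun U => ⟨?_, ?_⟩)
    · rintro ⟨f, hf, rfl⟩
      exact ⟨_, ⟨⟨f, hf⟩, rfl⟩, rfl⟩
    · rintro ⟨_, ⟨f, rfl⟩, rfl⟩
      exact ⟨f.1, f.2, rfl⟩
  exact hφ.noetherianSpace

variable (k) in
theorem continuous_mul_left_zariskiTopology (g : G) :
    @Continuous G G (zariskiTopology k G) (zariskiTopology k G) (fun x => g * x) := by
  let _ := zariskiTopology k G
  refine continuous_generateFrom_iff.2 ?_
  rintro _ ⟨f, hf, rfl⟩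
  exact TopologicalSpace.isOpen_generateFrom_of_mem ⟨_, left_translate_mem hf g, rfl⟩

/-- By homogeneity every point of `G` has an irreducible open neighbourhood, so the irreducible
components of `G` are open. -/
theorem IsZariskiConnected.irreducibleSpace (hG : IsZariskiConnected k G) :
    @IrreducibleSpace G (zariskiTopology k G) := by
  let _ := zariskiTopology k G
  have := noetherianSpace_zariskiTopology k G
  have : ConnectedSpace G := hG
  let Z := irreducibleComponent (1 : G)
  have hZ : Z ∈ irreducibleComponents G := irreducibleComponent_mem_irreducibleComponents 1
  obtain ⟨o, ho, ⟨x₀, hx₀⟩, hoZ⟩ :=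
    TopologicalSpace.NoetherianSpace.exists_isOpen_nonempty_subset_irreducibleComponent Z hZ
  have hloc : ∀ y : G, ∃ U : Set G, IsOpen U ∧ y ∈ U ∧ IsIrreducible U := fun y => by
    have hc := continuous_mul_left_zariskiTopology k (x₀ * y⁻¹)
    have hc' := continuous_mul_left_zariskiTopology k (y * x₀⁻¹)
    have : (fun x => y * x₀⁻¹ * x) '' o = (fun x => x₀ * y⁻¹ * x) ⁻¹' o := by
      ext x
      refine ⟨?_, fun hx => ⟨_, hx, by group⟩⟩
      rintro ⟨z, hz, rfl⟩
      simpa [mul_assoc] using hz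
    refine ⟨(fun x => x₀ * y⁻¹ * x) ⁻¹' o, ho.preimage hc, by simpa using hx₀, ?_⟩
    rw [← this]
    have hoI : IsIrreducible o := ⟨⟨x₀, hx₀⟩, hZ.1.2.open_subset ho hoZ⟩
    exact hoI.image _ hc'.continuousOn
  have hopen : IsOpen Z := by
    refine isOpen_iff_mem_nhds.2 fun y hy => ?_
    obtain ⟨U, hU, hyU, hUI⟩ := hloc y
    have h1 : Z ⊆ closure U :=
      (subset_closure_inter_of_isPreirreducible_of_isOpen hZ.1.2 hU ⟨y, hy, hyU⟩).trans
        (closure_mono Set.inter_subset_right)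
    exact Filter.mem_of_superset (hU.mem_nhds hyU)
      (subset_closure.trans (hZ.2 hUI.closure h1))
  have huniv : Z = Set.univ :=
    IsClopen.eq_univ ⟨isClosed_irreducibleComponent, hopen⟩ ⟨1, mem_irreducibleComponent⟩
  rw [irreducibleSpace_def, Set.top_eq_univ, ← huniv]
  exact hZ.1

theorem IsZariskiConnected.isDomain (hG : IsZariskiConnected k G) :
    IsDomain (regularFunctions k G) := by
  let _ := zariskiTopology k G
  have := hG.irreducibleSpace
  have : NoZeroDivisors (regularFunctions k G) := ⟨fun {a b} hab => by
    by_contra! h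
    have hne : ∀ f : regularFunctions k G, f ≠ 0 → {x | f.1 x ≠ 0}.Nonempty := fun f hf => by
      by_contra h0
      exact hf (Subtype.ext (funext fun x => by_contra fun hx => h0 ⟨x, hx⟩))
    have hop : ∀ f : regularFunctions k G, IsOpen {x | f.1 x ≠ 0} := fun f =>
      TopologicalSpace.isOpen_generateFrom_of_mem ⟨_, f.2, rfl⟩
    obtain ⟨x, hx, hx'⟩ := nonempty_preirreducible_inter (hop a) (hop b) (hne a h.1) (hne b h.2)
    exact (mul_ne_zero hx hx') (congrFun (congrArg Subtype.val hab) x)⟩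
  have : Nontrivial (regularFunctions k G) := inferInstance
  exact NoZeroDivisors.to_isDomain _

/-- The only right-invariant rational functions are the constants. -/
theorem exists_algebraMap_eq_of_right_invariant [IsDomain (regularFunctions k G)]
    {K : Type*} [Field K] [Algebra (regularFunctions k G) K]
    [IsFractionRing (regularFunctions k G) K] [Algebra k K]
    [IsScalarTower k (regularFunctions k G) K] {ρ : G → K →+* K}
    (hρ : ∀ g f, ρ g (algebraMap _ K f) = algebraMap _ K (rightRegular k g f)) (κ : K)
    (hκ : ∀ g : G, ρ g κ = κ) : ∃ l : k, algebraMap k K l = κ := by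
  obtain ⟨u, v, hv, rfl⟩ := IsFractionRing.div_surjective (A := regularFunctions k G) κ
  have hv0 : v ≠ 0 := nonZeroDivisors.ne_zero hv
  have hinj := IsFractionRing.injective (regularFunctions k G) K
  obtain ⟨y, hy⟩ : ∃ y, v.1 y ≠ 0 := by
    by_contra! h
    exact hv0 (Subtype.ext (funext h))
  have hv' : algebraMap _ K v ≠ 0 := by
    rwa [Ne, map_eq_zero_iff _ hinj]
  refine ⟨u.1 y / v.1 y, ?_⟩
  rw [eq_div_iff hv', IsScalarTower.algebraMap_apply k (regularFunctions k G), ← map_mul]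
  refine congrArg _ (Subtype.ext (funext fun z => ?_))
  have h1 := hκ (y⁻¹ * z)
  have hvg : rightRegular k (y⁻¹ * z) v ≠ 0 := by simpa using hv0
  rw [map_div₀, hρ, hρ, div_eq_div_iff (by rwa [Ne, map_eq_zero_iff _ hinj]) hv', ← map_mul,
    ← map_mul] at h1
  have h2 := congrFun (congrArg Subtype.val (hinj h1)) y
  change u.1 (y * (y⁻¹ * z)) * v.1 y = u.1 y * v.1 (y * (y⁻¹ * z)) at h2
  rw [mul_inv_cancel_left] at h2
  change u.1 y / v.1 y * v.1 z = u.1 z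
  field_simp
  rw [h2.symm, mul_comm]

end Group

/-! ### Regular functions from `G` to `R` -/

section RegularMaps

open scoped TensorProduct

variable {k : Type*} [Field k] {G : Type*} [Group G] [AffineAlgebraicGroup k G]
  {R : Type*} [Ring R] [Algebra k R]

variable (k G R) in
/-- The algebra `k[G] ⊗ R` of regular maps `G → R`. -/
abbrev RegularMaps : Type _ := regularFunctions k G ⊗[k] R

instance : Ring (RegularMaps k G R) := Algebra.TensorProduct.instRing

instance : AddCommGroup (RegularMaps k G R) := Ring.toAddCommGroup

variable (k G R) in
/-- The function `G → R` given by an element of `k[G] ⊗ R`. -/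
def evalMap : RegularMaps k G R →ₐ[k] (G → R) :=
  Algebra.TensorProduct.lift
    (AlgHom.pi fun x => (Algebra.ofId k R).comp (evalPoint k x))
    (Pi.constAlgHom k G R)
    fun f r => funext fun x => Algebra.commutes (f.1 x) r

@[simp] theorem evalMap_tmul (f : regularFunctions k G) (r : R) (x : G) :
    evalMap k G R (f ⊗ₜ r) x = f.1 x • r := by
  rw [Algebra.smul_def]
  exact congrFun (Algebra.TensorProduct.lift_tmul _ _ _ f r) x

theorem evalMap_smul (f : regularFunctions k G) (F : RegularMaps k G R) (x : G) :
    evalMap k G R (f • F) x = f.1 x • evalMap k G R F x := by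
  induction F using TensorProduct.induction_on with
  | zero => simp
  | tmul g r =>
    rw [TensorProduct.smul_tmul', evalMap_tmul, evalMap_tmul, smul_smul]
    rfl
  | add F F' h h' => rw [smul_add, map_add, map_add, Pi.add_apply, Pi.add_apply, h, h', smul_add]

/-- Composition of a regular map with a linear functional is a regular function. -/
theorem dual_evalMap_mem (F : RegularMaps k G R) (ξ : Module.Dual k R) :
    (fun x => ξ (evalMap k G R F x)) ∈ regularFunctions k G := by
  induction F using TensorProduct.induction_on with
  | zero =>
    convert (regularFunctions k G).zero_mem using 1
    ext x
    simp
  | tmul f r =>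
    have := (regularFunctions k G).smul_mem f.2 (ξ r)
    convert this using 1
    ext x
    simp [mul_comm]
  | add F F' h h' =>
    convert (regularFunctions k G).add_mem h h' using 1
    ext x
    simp

theorem evalMap_injective : Function.Injective (evalMap k G R) := by
  refine (injective_iff_map_eq_zero _).2 fun F hF => ?_
  let b := Module.Basis.ofVectorSpace k R
  let B := b.baseChange (regularFunctions k G)
  have key : ∀ F x i, (B.repr F i).1 x = b.repr (evalMap k G R F x) i := by
    intro F x i
    induction F using TensorProduct.induction_on with
    | zero => simp
    | tmul f r => simp [B, mul_comm]
    | add F F' h h' => simp [h, h']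
  refine B.repr.map_eq_zero_iff.1 (Finsupp.ext fun i => Subtype.ext (funext fun x => ?_))
  rw [key, hF]
  simp

theorem evalMap_ext {F F' : RegularMaps k G R} (h : ∀ x, evalMap k G R F x = evalMap k G R F' x) :
    F = F' := evalMap_injective (funext h)

/-- If at each point `x` of the irreducible variety `G` one has `F(x) ∈ V` or `F'(x) ∈ V'`, then one
of the two alternatives holds at all points. -/
theorem forall_mem_or_forall_mem [IsDomain (regularFunctions k G)] (F F' : RegularMaps k G R)
    (V V' : Submodule k R) (h : ∀ x, evalMap k G R F x ∈ V ∨ evalMap k G R F' x ∈ V') :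
    (∀ x, evalMap k G R F x ∈ V) ∨ ∀ x, evalMap k G R F' x ∈ V' := by
  by_contra! h0
  obtain ⟨⟨x, hx⟩, y, hy⟩ := h0
  obtain ⟨ξ, hξ, hξV⟩ := Submodule.exists_le_ker_of_notMem hx
  obtain ⟨ξ', hξ', hξV'⟩ := Submodule.exists_le_ker_of_notMem hy
  let f : regularFunctions k G := ⟨_, dual_evalMap_mem F ξ⟩
  let f' : regularFunctions k G := ⟨_, dual_evalMap_mem F' ξ'⟩
  have : f * f' = 0 := Subtype.ext <| funext fun z => by
    change ξ (evalMap k G R F z) * ξ' (evalMap k G R F' z) = 0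
    rcases h z with hz | hz
    · rw [LinearMap.mem_ker.1 (hξV hz), zero_mul]
    · rw [LinearMap.mem_ker.1 (hξV' hz), mul_zero]
  rcases mul_eq_zero.1 this with h1 | h1
  · exact hξ (congrFun (congrArg Subtype.val h1) x)
  · exact hξ' (congrFun (congrArg Subtype.val h1) y)

/-- A regular map with values in a subspace `V` is a sum of tensors `f ⊗ r` with `r ∈ V`, so an
additive map that vanishes on these tensors vanishes on it. -/
theorem map_eq_zero_of_forall_mem {X : Type*} [AddCommMonoid X] (θ : RegularMaps k G R →+ X)
    (V : Submodule k R) (hθ : ∀ f, ∀ r ∈ V, θ (f ⊗ₜ r) = 0) {F : RegularMaps k G R}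
    (hF : ∀ x, evalMap k G R F x ∈ V) : θ F = 0 := by
  obtain ⟨p, hp⟩ := V.subtype.exists_leftInverse_of_injective V.ker_subtype
  let π : R →ₗ[k] R := V.subtype ∘ₗ p
  have hπ : π.lTensor _ F = F := evalMap_ext fun x => by
    have : ∀ F : RegularMaps k G R, evalMap k G R (π.lTensor _ F) x = π (evalMap k G R F x) :=
      fun F => by
        induction F using TensorProduct.induction_on with
        | zero => simp
        | tmul f r => simp
        | add F F' h h' => simp only [map_add, Pi.add_apply, h, h']
    rw [this]
    exact congrArg Subtype.val (LinearMap.congr_fun hp ⟨_, hF x⟩)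
  rw [← hπ]
  clear hπ hF
  induction F using TensorProduct.induction_on with
  | zero => simp
  | tmul f r => exact hθ f _ (p r).2
  | add F F' h h' => rw [map_add, map_add, h, h', add_zero]

theorem exists_evalMap_eq_inv (F : RegularMaps k G R) :
    ∃ F' : RegularMaps k G R, ∀ x, evalMap k G R F' x = evalMap k G R F x⁻¹ := by
  induction F using TensorProduct.induction_on with
  | zero => exact ⟨0, by simp⟩
  | tmul f r => exact ⟨⟨_, AffineAlgebraicGroup.inv_regular f.1 f.2⟩ ⊗ₜ r, by simp⟩
  | add F F' h h' =>
    obtain ⟨F₁, h₁⟩ := h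
    obtain ⟨F₂, h₂⟩ := h'
    exact ⟨F₁ + F₂, by simp [h₁, h₂]⟩

variable [MulSemiringAction G R] [SMulCommClass G k R]

/-- The orbit maps `x ↦ x • r` of a rational action are regular. -/
theorem IsRationalAction.exists_evalMap_eq (hR : IsRationalAction k G R) (r : R) :
    ∃ F : RegularMaps k G R, ∀ x, evalMap k G R F x = x • r := by
  let V := Submodule.span k (MulAction.orbit G r)
  have hV : ∀ g : G, ∀ v ∈ V, g • v ∈ V := fun g v hv => by
    have : V ≤ V.comap (DistribSMul.toLinearMap k R g) := by
      refine Submodule.span_le.2 ?_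
      rintro _ ⟨h, rfl⟩
      exact Submodule.subset_span ⟨g * h, mul_smul g h r⟩
    exact this hv
  have : FiniteDimensional k V := hR.locallyFinite r
  let b := Module.finBasis k V
  have hr : r ∈ V := Submodule.subset_span (MulAction.mem_orbit_self r)
  refine ⟨∑ i, (⟨_, hR.regular_coeff V hV this ⟨r, hr⟩ (b.coord i)⟩ : regularFunctions k G) ⊗ₜ
    (b i : R), fun x => ?_⟩
  have := congrArg Subtype.val (b.sum_repr ⟨x • r, hV x r hr⟩)
  rw [map_sum, Finset.sum_apply]
  simp only [evalMap_tmul]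
  rwa [Submodule.coe_sum] at this

variable (k) in
/-- The algebra homomorphism sending `r` to the map `x ↦ x⁻¹ • r`. -/
def invOrbitHom : R →ₐ[k] (G → R) :=
  AlgHom.pi fun x => (MulSemiringAction.toAlgEquiv k R x⁻¹).toAlgHom

theorem IsRationalAction.invOrbitHom_mem_range (hR : IsRationalAction k G R) (r : R) :
    invOrbitHom k r ∈ (evalMap k G R).range := by
  obtain ⟨F, hF⟩ := hR.exists_evalMap_eq r
  obtain ⟨F', hF'⟩ := exists_evalMap_eq_inv F
  exact ⟨F', funext fun x => (hF' x).trans (hF x⁻¹)⟩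

/-- The coaction `R → k[G] ⊗ R` sending `r` to the regular map `x ↦ x⁻¹ • r`. -/
def invCoaction (hR : IsRationalAction k G R) : R →ₐ[k] RegularMaps k G R :=
  (AlgEquiv.ofInjective (evalMap k G R) evalMap_injective).symm.toAlgHom.comp
    ((invOrbitHom k).codRestrict (evalMap k G R).range hR.invOrbitHom_mem_range)

theorem evalMap_invCoaction (hR : IsRationalAction k G R) (r : R) (x : G) :
    evalMap k G R (invCoaction hR r) x = x⁻¹ • r := by
  have := AlgEquiv.apply_symm_apply (AlgEquiv.ofInjective (evalMap k G R) evalMap_injective)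
    ((invOrbitHom k).codRestrict (evalMap k G R).range hR.invOrbitHom_mem_range r)
  exact congrFun (congrArg Subtype.val this) x

/-- The `k[G]`-linear map of `k[G] ⊗ R` sending `F` to the regular map `x ↦ x⁻¹ • F(x)`. -/
def untwist (hR : IsRationalAction k G R) :
    RegularMaps k G R →ₗ[regularFunctions k G] RegularMaps k G R :=
  TensorProduct.AlgebraTensorModule.lift
    ((LinearMap.toSpanSingleton (regularFunctions k G)
      (R →ₗ[k] RegularMaps k G R) (invCoaction hR).toLinearMap))

theorem untwist_tmul (hR : IsRationalAction k G R) (f : regularFunctions k G) (r : R) :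
    untwist hR (f ⊗ₜ r) = f • invCoaction hR r := rfl

theorem evalMap_untwist (hR : IsRationalAction k G R) (F : RegularMaps k G R) (x : G) :
    evalMap k G R (untwist hR F) x = x⁻¹ • evalMap k G R F x := by
  induction F using TensorProduct.induction_on with
  | zero => simp
  | tmul f r =>
    rw [untwist_tmul, evalMap_smul, evalMap_invCoaction, evalMap_tmul, ← smul_comm]
  | add F F' h h' => rw [map_add, map_add, Pi.add_apply, h, h', map_add, Pi.add_apply, smul_add]

/-- For a regular map `F`, the map `x ↦ x • F(x)` is regular. -/
theorem IsRationalAction.exists_twist (hR : IsRationalAction k G R) (F : RegularMaps k G R) :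
    ∃ F' : RegularMaps k G R, ∀ x, evalMap k G R F' x = x • evalMap k G R F x := by
  induction F using TensorProduct.induction_on with
  | zero => exact ⟨0, by simp⟩
  | tmul f r =>
    obtain ⟨F, hF⟩ := hR.exists_evalMap_eq r
    exact ⟨f • F, fun x => by rw [evalMap_smul, hF, evalMap_tmul, ← smul_comm]⟩
  | add F F' h h' =>
    obtain ⟨F₁, h₁⟩ := h
    obtain ⟨F₂, h₂⟩ := h'
    exact ⟨F₁ + F₂, fun x => by rw [map_add, map_add, Pi.add_apply, Pi.add_apply, h₁, h₂, smul_add]⟩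

/-- The operator on `k[G] ⊗ R` sending `F` to the regular map `x ↦ g • F(x g)`. -/
def diagAction (g : G) : RegularMaps k G R →ₗ[k] RegularMaps k G R :=
  TensorProduct.map (rightRegular k g).toLinearMap (DistribSMul.toLinearMap k R g)

theorem diagAction_tmul (g : G) (f : regularFunctions k G) (r : R) :
    diagAction g (f ⊗ₜ[k] r) = rightRegular k g f ⊗ₜ (g • r) := rfl

theorem evalMap_diagAction (g : G) (F : RegularMaps k G R) (x : G) :
    evalMap k G R (diagAction g F) x = g • evalMap k G R F (x * g) := by
  induction F using TensorProduct.induction_on with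
  | zero => simp
  | tmul f r =>
    rw [diagAction_tmul, evalMap_tmul, evalMap_tmul, ← smul_comm]
    rfl
  | add F F' h h' => rw [map_add, map_add, map_add, Pi.add_apply, Pi.add_apply, h, h', smul_add]

theorem diagAction_invCoaction (hR : IsRationalAction k G R) (g : G) (r : R) :
    diagAction g (invCoaction hR r) = invCoaction hR r :=
  evalMap_ext fun x => by
    rw [evalMap_diagAction, evalMap_invCoaction, evalMap_invCoaction, smul_smul, mul_inv_rev,
      mul_inv_cancel_left]

end RegularMaps

/-! ### For connected groups, `G`-prime ideals are prime -/

section GPrime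

variable {k : Type*} [Field k] {R : Type*} [Ring R] [Algebra k R]

variable (k) in
/-- A two-sided ideal as a `k`-subspace. -/
def idealSubmodule (P : TwoSidedIdeal R) : Submodule k R where
  carrier := P
  add_mem' := P.add_mem
  zero_mem' := P.zero_mem
  smul_mem' l x hx := by
    rw [Algebra.smul_def]
    exact P.mul_mem_left _ _ hx

@[simp] theorem mem_idealSubmodule {P : TwoSidedIdeal R} {x : R} :
    x ∈ idealSubmodule k P ↔ x ∈ P := Iff.rfl

variable (k) in
theorem smul_mem_ideal (P : TwoSidedIdeal R) (l : k) {x : R} (hx : x ∈ P) : l • x ∈ P :=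
  (idealSubmodule k P).smul_mem l hx

variable {G : Type*} [Group G] [MulSemiringAction G R]

theorem mem_core {P : TwoSidedIdeal R} {x : R} : x ∈ core G P ↔ ∀ g : G, g • x ∈ P := by
  simp only [core, TwoSidedIdeal.mem_iInf, mem_translate]
  exact ⟨fun h g => by simpa using h g⁻¹, fun h g => h g⁻¹⟩

theorem core_le (P : TwoSidedIdeal R) : core G P ≤ P := fun x hx => by
  simpa using mem_core.1 hx 1

/-- The elementwise form of `G`-primeness, tested on the left annihilator modulo `I` of the orbit
of `b` and on the right annihilator of this ideal. -/
theorem IsGPrime.mem_or_mem {I : TwoSidedIdeal R} (hI : IsGPrime G I) {a b : R}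
    (h : ∀ (r : R) (y : G), a * r * (y • b) ∈ I) : a ∈ I ∨ b ∈ I := by
  let A := leftColon I (MulAction.orbit G b)
  have hA : IsStable G A := fun g x hx => mem_leftColon.2 <| by
    rintro _ ⟨y, rfl⟩ r
    simpa [smul_mul', mul_smul] using
      hI.isStable g _ (mem_leftColon.1 hx _ ⟨g⁻¹ * y, rfl⟩ (g⁻¹ • r))
  have hB : IsStable G (rightColon I A) := fun g y hy => mem_rightColon.2 fun x hx => by
    simpa [smul_mul'] using hI.isStable g _ (mem_rightColon.1 hy _ (hA g⁻¹ x hx))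
  refine (hI.le_or_le A _ hA hB (idealMul_rightColon_le I A)).imp
    (fun h' => h' (mem_leftColon.2 ?_))
    (fun h' => h' (mem_rightColon_leftColon (MulAction.mem_orbit_self b)))
  rintro _ ⟨y, rfl⟩ r
  exact h r y

variable [AffineAlgebraicGroup k G] [SMulCommClass G k R]

/-- Every `G`-prime ideal `I` is the core of a prime ideal: an ideal maximal among those with
core `I` is prime. Local finiteness of the action provides upper bounds for chains. -/
theorem IsGPrime.exists_isPrimeIdeal_core_eq (hR : IsRationalAction k G R) {I : TwoSidedIdeal R}
    (hI : IsGPrime G I) : ∃ P, IsPrimeIdeal P ∧ core G P = I := by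
  have hIcore : ∀ {P : TwoSidedIdeal R}, I ≤ P → I ≤ core G P := fun hP x hx =>
    mem_core.2 fun g => hP (hI.isStable g x hx)
  obtain ⟨P, -, ⟨hIP, hPI⟩, hmax⟩ := zorn_le_nonempty₀
    {P : TwoSidedIdeal R | I ≤ P ∧ core G P ≤ I} (fun c hc hch P₀ hP₀ => by
      let U : TwoSidedIdeal R := .mk' {x | ∃ P ∈ c, x ∈ P} ⟨P₀, hP₀, P₀.zero_mem⟩
        (by
          rintro x y ⟨P, hP, hx⟩ ⟨P', hP', hy⟩
          rcases hch.total hP hP' with h | h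
          · exact ⟨P', hP', P'.add_mem (h hx) hy⟩
          · exact ⟨P, hP, P.add_mem hx (h hy)⟩)
        (by rintro x ⟨P, hP, hx⟩; exact ⟨P, hP, P.neg_mem hx⟩)
        (by rintro x y ⟨P, hP, hx⟩; exact ⟨P, hP, P.mul_mem_left _ _ hx⟩)
        (by rintro x y ⟨P, hP, hx⟩; exact ⟨P, hP, P.mul_mem_right _ _ hx⟩)
      have hU : ∀ x, x ∈ U ↔ ∃ P ∈ c, x ∈ P := fun x => by
        simp only [U, TwoSidedIdeal.mem_mk', Set.mem_ofPred_eq]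
      refine ⟨U, ⟨fun x hx => (hU x).2 ⟨P₀, hP₀, (hc hP₀).1 hx⟩, fun r hr => ?_⟩,
        fun P hP x hx => (hU x).2 ⟨P, hP, hx⟩⟩
      -- The orbit of `r` spans a finite-dimensional space, so it lies in a member of the chain.
      obtain ⟨s, hs, hspan⟩ := Submodule.fg_span_iff_fg_span_finset_subset (R := k)
        (MulAction.orbit G r) |>.1 (Module.Finite.iff_fg.1 (hR.locallyFinite r))
      obtain ⟨P, hP, hsP⟩ := DirectedOn.exists_mem_subset_of_finset_subset_biUnion
        (f := fun P : TwoSidedIdeal R => (P : Set R)) ⟨P₀, hP₀⟩ (s := s)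
        (fun P hP P' hP' => by
          rcases hch.total hP hP' with h | h
          · exact ⟨P', hP', h, subset_rfl⟩
          · exact ⟨P, hP, subset_rfl, h⟩)
        (fun x hx => by
          obtain ⟨g, rfl⟩ := hs hx
          obtain ⟨P, hP, h⟩ := (hU _).1 (mem_core.1 hr g)
          exact Set.mem_biUnion hP h)
      have hle : Submodule.span k (MulAction.orbit G r) ≤ idealSubmodule k P :=
        hspan ▸ Submodule.span_le.2 hsP
      exact (hc hP).2 (mem_core.2 fun g => hle (Submodule.subset_span ⟨g, rfl⟩)))
    I ⟨le_rfl, core_le I⟩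
  have hcore : ∀ {A : TwoSidedIdeal R}, P ≤ A → ¬A ≤ P → ∃ u ∈ core G A, u ∉ I := fun hPA hA =>
    Set.not_subset.1 fun h => hA (hmax ⟨hIP.trans hPA, h⟩ hPA)
  refine ⟨P, isPrimeIdeal_of_mem_or_mem ?_ fun a b hab => ?_, le_antisymm hPI (hIcore hIP)⟩
  · rintro rfl
    exact hI.ne_top (eq_top_iff.2 fun x _ => hPI (mem_core.2 fun g => TwoSidedIdeal.mem_top R))
  by_contra! h
  -- `A` and `rightColon P A` are ideals properly containing `P` with product inside `P`.
  let A := leftColon P {b}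
  obtain ⟨u, hu, huI⟩ := hcore (A := A)
    (fun x hx => mem_leftColon.2 fun _ _ r => P.mul_mem_right _ _ (P.mul_mem_right _ _ hx))
    fun hAP => h.1 (hAP (mem_leftColon.2 fun _ hb r => hb ▸ hab r))
  obtain ⟨v, hv, hvI⟩ := hcore (A := rightColon P A)
    (fun y hy => mem_rightColon.2 fun x _ => P.mul_mem_left _ _ hy)
    fun hBP => h.2 (hBP (mem_rightColon_leftColon rfl))
  refine (hI.mem_or_mem (a := u) (b := v) fun r y => hPI (mem_core.2 fun g => ?_)).elim huI hvI
  rw [smul_mul', smul_mul', ← mul_smul]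
  exact mem_rightColon.1 (mem_core.1 hv _) _ (A.mul_mem_right _ _ (mem_core.1 hu g))

/-- If `a R b ⊆ I` and `P` is a prime ideal with core `I`, then at each point `x` of the
irreducible variety `G` one has `x.a ∈ P` or `x.b ∈ P`, and so one alternative holds for all `x`. -/
theorem IsGPrime.isPrimeIdeal [IsDomain (regularFunctions k G)] (hR : IsRationalAction k G R)
    {I : TwoSidedIdeal R} (hI : IsGPrime G I) : IsPrimeIdeal I := by
  obtain ⟨P, hP, hPI⟩ := hI.exists_isPrimeIdeal_core_eq hR
  refine isPrimeIdeal_of_mem_or_mem hI.ne_top fun a b hab => ?_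
  obtain ⟨Fa, hFa⟩ := hR.exists_evalMap_eq a
  obtain ⟨Fb, hFb⟩ := hR.exists_evalMap_eq b
  have := forall_mem_or_forall_mem Fa Fb (idealSubmodule k P) (idealSubmodule k P) fun x => by
    rw [hFa, hFb]
    refine hP.mem_or_mem fun r => core_le (G := G) P ?_
    rw [hPI]
    simpa [smul_mul'] using hI.isStable x _ (hab (x⁻¹ • r))
  simp only [hFa, hFb, mem_idealSubmodule, ← mem_core, hPI] at this
  exact this

end GPrime

/-! ### The homomorphism attached to a rational ideal -/

section Forward

open scoped TensorProduct

variable {k : Type*} [Field k] {G : Type*} [Group G] [AffineAlgebraicGroup k G]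
  {R : Type*} [Ring R] [Algebra k R]

/-- Nonzero regular functions can be cancelled from pointwise membership conditions. -/
theorem eq_zero_or_forall_mem [IsDomain (regularFunctions k G)] (w : regularFunctions k G)
    (F : RegularMaps k G R) (V : Submodule k R) (h : ∀ x, w.1 x • evalMap k G R F x ∈ V) :
    w = 0 ∨ ∀ x, evalMap k G R F x ∈ V := by
  rcases subsingleton_or_nontrivial R with hR | hR
  · exact Or.inr fun x => by rw [Subsingleton.elim (evalMap k G R F x) 0]; exact V.zero_mem
  refine (forall_mem_or_forall_mem (w ⊗ₜ[k] (1 : R)) F ⊥ V fun x => ?_).imp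
    (fun h0 => Subtype.ext (funext fun x => ?_)) id
  · rw [evalMap_tmul]
    rcases eq_or_ne (w.1 x) 0 with h0 | h0
    · exact Or.inl (by simp [h0])
    · exact Or.inr ((V.smul_mem_iff h0).1 (h x))
  · simpa using h0 x

variable {K : Type*} [Field K] [Algebra (regularFunctions k G) K]
  [IsFractionRing (regularFunctions k G) K]

theorem exists_common_denominator [IsDomain (regularFunctions k G)] {α : Type*} (s : Finset α)
    (κ : α → K) : ∃ v : regularFunctions k G, v ≠ 0 ∧ ∀ i ∈ s,
      ∃ u : regularFunctions k G, algebraMap _ K v * κ i = algebraMap _ _ u := by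
  obtain ⟨v, hv⟩ := IsLocalization.exist_integer_multiples
    (nonZeroDivisors (regularFunctions k G)) s κ
  refine ⟨v, nonZeroDivisors.ne_zero v.2, fun i hi => ?_⟩
  obtain ⟨u, hu⟩ := hv i hi
  exact ⟨u, by rw [hu]; exact (Algebra.smul_def _ _).symm⟩

variable [MulSemiringAction G R] {F : Type*} [CommRing F] {Q : Type*} [Ring Q] [Algebra F Q]

variable (k G) in
/-- The element `κ` of `K = k(G)` is the value at the element `c` of the extended centroid of the
homomorphism attached to `P`: whenever `κ = u / v` and `c a = b`, one has `v(x) x.b ≡ u(x) x.a`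
modulo `P` for all `x ∈ G`. The condition `v κ = u` also admits `v = 0`; it forces `u = 0`, and the
congruence is then trivial. -/
def IsCentroidValue (ι : R →+* Q) (P : TwoSidedIdeal R) (c : F) (κ : K) : Prop :=
  ∀ u v : regularFunctions k G, algebraMap _ K v * κ = algebraMap _ _ u →
    ∀ a b, c • ι a = ι b → ∀ x : G, v.1 x • x • b - u.1 x • x • a ∈ P

variable {I P : TwoSidedIdeal R} {ι : R →+* Q}

variable [SMulCommClass G k R]

/-- The fraction `u / v` in the congruence `v(x) x.b ≡ u(x) x.a` modulo `P` is determined by `a`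
and `b`, provided that `a` does not lie in the core of `P`. -/
theorem eq_of_forall_sub_mem [IsDomain (regularFunctions k G)] (hR : IsRationalAction k G R)
    (hcore : core G P = I) {u v u' v' : regularFunctions k G} {a b : R} (ha : a ∉ I)
    (h : ∀ x : G, v.1 x • x • b - u.1 x • x • a ∈ P)
    (h' : ∀ x : G, v'.1 x • x • b - u'.1 x • x • a ∈ P) : v * u' = v' * u := by
  obtain ⟨F, hF⟩ := hR.exists_evalMap_eq a
  refine sub_eq_zero.1 ((eq_zero_or_forall_mem (v * u' - v' * u) F (idealSubmodule k P)
    fun x => ?_).resolve_right fun hx => ha ?_)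
  · have := P.sub_mem (smul_mem_ideal k P (v'.1 x) (h x)) (smul_mem_ideal k P (v.1 x) (h' x))
    rw [hF, mem_idealSubmodule]
    change (v.1 x * u'.1 x - v'.1 x * u.1 x) • x • a ∈ P
    generalize x • a = a' at this ⊢
    generalize x • b = b' at this
    convert this using 1
    module
  · rw [← hcore]
    exact mem_core.2 fun g => hF g ▸ hx g

/-- A value is determined by a single fraction `c = b / a` and a single fraction `κ' = u / v`. -/
theorem IsCentroidValue.eq [IsDomain (regularFunctions k G)] (hR : IsRationalAction k G R)
    (hcore : core G P = I) {c : F} {κ κ' : K}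
    (hκ : IsCentroidValue k G ι P c κ) {a b : R} (ha : a ∉ I) (hab : c • ι a = ι b)
    {u v : regularFunctions k G} (hv : v ≠ 0)
    (hκ' : algebraMap _ K v * κ' = algebraMap _ _ u)
    (h : ∀ x : G, v.1 x • x • b - u.1 x • x • a ∈ P) : κ = κ' := by
  have hinj := IsFractionRing.injective (regularFunctions k G) K
  obtain ⟨u₀, v₀, hv₀, rfl⟩ := IsFractionRing.div_surjective (A := regularFunctions k G) κ
  have hv₀' : algebraMap _ K v₀ ≠ 0 := by
    rw [Ne, map_eq_zero_iff _ hinj]; exact nonZeroDivisors.ne_zero hv₀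
  have hv' : algebraMap _ K v ≠ 0 := by
    rwa [Ne, map_eq_zero_iff _ hinj]
  have := eq_of_forall_sub_mem hR hcore ha h
    (hκ u₀ v₀ (mul_div_cancel₀ _ hv₀') a b hab)
  rw [div_eq_iff hv₀']
  refine mul_left_cancel₀ hv' ?_
  rw [← mul_assoc, hκ', ← map_mul, this, map_mul, mul_comm]

variable (h : IsMartindaleExtension F I ι)
include h

omit [AffineAlgebraicGroup k G] [SMulCommClass G k R] in
/-- At each point `x ∈ G` at which `c` is defined modulo `P`, the element `c` of the extended
centroid of `R/I` induces an element of the extended centroid `k` of `R/P`. -/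
theorem exists_scalar_of_smul_notMem (hP : IsRational k P) (hcore : core G P = I) (c : F)
    {a₀ b₀ : R} (hab₀ : c • ι a₀ = ι b₀) {x : G} (hx : x • a₀ ∉ P) :
    ∃ l : k, ∀ a b, c • ι a = ι b → x • b - l • x • a ∈ P := by
  obtain ⟨l, hl⟩ := hP.exists_scalar
    (W := fun a b => c • ι (x⁻¹ • a) = ι (x⁻¹ • b))
    { add := fun hab hab' => by
        rw [smul_add, smul_add, map_add, smul_add, hab, hab', map_add]
      mul_left := fun r hab => by
        rw [smul_mul', smul_mul', map_mul, ← mul_smul_comm, hab, map_mul]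
      mul_right := fun r hab => by
        rw [smul_mul', smul_mul', map_mul, ← smul_mul_assoc, hab, map_mul]
      mem := fun {a b} hab ha => by
        refine (hP.isPrime.mem_or_mem (b := x • a₀) fun r => ?_).resolve_right hx
        have : x⁻¹ • b * x⁻¹ • r * a₀ - x⁻¹ • a * x⁻¹ • r * b₀ ∈ I := by
          rw [← h.eq_iff, map_mul, map_mul, ← hab, map_mul, map_mul, ← hab₀, smul_mul_assoc,
            smul_mul_assoc, mul_smul_comm]
        rw [← hcore] at this
        have := mem_core.1 this x
        rw [smul_sub, smul_mul', smul_mul', smul_mul', smul_mul', smul_inv_smul, smul_inv_smul,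
          smul_inv_smul] at this
        simpa using P.add_mem this (P.mul_mem_right _ (x • b₀) (P.mul_mem_right _ r ha))
      exists_notMem := ⟨x • a₀, x • b₀, by rwa [inv_smul_smul, inv_smul_smul], hx⟩ }
  exact ⟨l, fun a b hab => hl _ _ (by rwa [inv_smul_smul, inv_smul_smul])⟩

variable (K) in
/-- With `c a₀ = b₀` and a linear form `ξ` that vanishes on `P` but not on the orbit of `a₀`, the
value is the quotient of the regular functions `x ↦ ξ(x.b₀)` and `x ↦ ξ(x.a₀)`. -/
theorem exists_isCentroidValue [IsDomain (regularFunctions k G)] (hR : IsRationalAction k G R)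
    (hP : IsRational k P) (hcore : core G P = I) (c : F) :
    ∃ κ : K, IsCentroidValue k G ι P c κ := by
  have hinj := IsFractionRing.injective (regularFunctions k G) K
  obtain ⟨a₀, b₀, hab₀, ha₀⟩ := h.exists_smul_eq c
  obtain ⟨x₀, hx₀⟩ : ∃ x : G, x • a₀ ∉ P := by
    by_contra! h0
    exact ha₀ (hcore ▸ mem_core.2 h0)
  obtain ⟨ξ, hξ, hξP⟩ := Submodule.exists_le_ker_of_notMem
    (show x₀ • a₀ ∉ idealSubmodule k P from hx₀)
  obtain ⟨Fa, hFa⟩ := hR.exists_evalMap_eq a₀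
  obtain ⟨Fb, hFb⟩ := hR.exists_evalMap_eq b₀
  let u₀ : regularFunctions k G := ⟨_, dual_evalMap_mem Fb ξ⟩
  let v₀ : regularFunctions k G := ⟨_, dual_evalMap_mem Fa ξ⟩
  have hu₀ : ∀ x, u₀.1 x = ξ (x • b₀) := fun x => congrArg ξ (hFb x)
  have hv₀ : ∀ x, v₀.1 x = ξ (x • a₀) := fun x => congrArg ξ (hFa x)
  have hv₀0 : v₀ ≠ 0 := fun h0 => hξ <| by rw [← hv₀, h0]; rfl
  have hv₀' : algebraMap _ K v₀ ≠ 0 := by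
    rwa [Ne, map_eq_zero_iff _ hinj]
  refine ⟨algebraMap _ _ u₀ / algebraMap _ _ v₀, fun u v huv a b hab => ?_⟩
  have huv' : v * u₀ = u * v₀ := hinj <| by
    rw [map_mul, map_mul, ← huv, mul_assoc, div_mul_cancel₀ _ hv₀']
  obtain ⟨Fa', hFa'⟩ := hR.exists_evalMap_eq a
  obtain ⟨Fb', hFb'⟩ := hR.exists_evalMap_eq b
  have key := (eq_zero_or_forall_mem v₀ (v • Fb' - u • Fa') (idealSubmodule k P)
    fun x => ?_).resolve_left hv₀0
  · intro x
    have := key x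
    rwa [map_sub, Pi.sub_apply, evalMap_smul, evalMap_smul, hFa', hFb'] at this
  · rw [map_sub, Pi.sub_apply, evalMap_smul, evalMap_smul, hFa', hFb', mem_idealSubmodule]
    rcases eq_or_ne (v₀.1 x) 0 with h0 | h0
    · rw [h0, zero_smul]; exact P.zero_mem
    refine smul_mem_ideal k P _ ?_
    have hx : x • a₀ ∉ P := fun hx => h0 ((hv₀ x).trans (hξP hx))
    obtain ⟨l, hl⟩ := exists_scalar_of_smul_notMem h hP hcore c hab₀ hx
    have h1 : u₀.1 x = l * v₀.1 x := by
      rw [hu₀, hv₀, ← smul_eq_mul, ← map_smul, ← sub_eq_zero, ← map_sub]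
      exact hξP (hl a₀ b₀ hab₀)
    have h2 : v.1 x * u₀.1 x = u.1 x * v₀.1 x := congrFun (congrArg Subtype.val huv') x
    have h3 : u.1 x = v.1 x * l := mul_right_cancel₀ h0 (by rw [← h2, h1, mul_assoc])
    rw [h3, mul_smul, ← smul_sub]
    exact smul_mem_ideal k P _ (hl a b hab)

variable [Algebra k F] [Algebra k K] [IsScalarTower k (regularFunctions k G) K]
  (hk : ∀ (l : k) (a : R), ι (l • a) = algebraMap k F l • ι a)
include hk

variable (K) in
/-- The homomorphism from the extended centroid of `R/I` to `k(G)` attached to a rational ideal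
`P` with core `I`. -/
theorem exists_algHom_isCentroidValue [IsDomain (regularFunctions k G)]
    (hR : IsRationalAction k G R) (hP : IsRational k P) (hcore : core G P = I) :
    ∃ ψ : F →ₐ[k] K, ∀ c, IsCentroidValue k G ι P c (ψ c) := by
  choose ψ hψ using exists_isCentroidValue K h hR hP hcore
  -- Elements `c`, `c'` of the extended centroid have the common denominator `a₁ r a₂`.
  have hcommon : ∀ c c' : F, ∃ a₁ b₁ r a₂ b₂, a₁ * r * a₂ ∉ I ∧ c • ι a₁ = ι b₁ ∧
      c' • ι a₂ = ι b₂ := fun c c' => by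
    obtain ⟨a₁, b₁, h₁, ha₁⟩ := h.exists_smul_eq c
    obtain ⟨a₂, b₂, h₂, ha₂⟩ := h.exists_smul_eq c'
    obtain ⟨r, hr⟩ := h.isPrime.exists_mul_mul_notMem ha₁ ha₂
    exact ⟨a₁, b₁, r, a₂, b₂, hr, h₁, h₂⟩
  have hden : ∀ κ κ' : K, ∃ v u u' : regularFunctions k G, v ≠ 0 ∧
      algebraMap _ K v * κ = algebraMap _ _ u ∧
      algebraMap _ K v * κ' = algebraMap _ _ u' := fun κ κ' => by
    obtain ⟨v, hv, hv'⟩ := exists_common_denominator (k := k) (G := G) Finset.univ ![κ, κ']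
    obtain ⟨u, hu⟩ := hv' 0 (Finset.mem_univ _)
    obtain ⟨u', hu'⟩ := hv' 1 (Finset.mem_univ _)
    exact ⟨v, u, u', hv, hu, hu'⟩
  have hcomm : ∀ l : k, ψ (algebraMap k F l) = algebraMap k _ l := fun l =>
    (hψ _).eq hR hcore (a := 1) (b := l • 1) h.isPrime.one_notMem (hk l 1).symm
      (u := algebraMap k _ l) (v := 1) one_ne_zero
      (by rw [map_one, one_mul, IsScalarTower.algebraMap_apply k (regularFunctions k G)])
      fun x => by
        change (1 : k) • x • (l • (1 : R)) - l • x • (1 : R) ∈ P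
        rw [one_smul, smul_comm, sub_self]
        exact P.zero_mem
  have hadd : ∀ c c', ψ (c + c') = ψ c + ψ c' := fun c c' => by
    obtain ⟨a₁, b₁, r, a₂, b₂, hr, h₁, h₂⟩ := hcommon c c'
    obtain ⟨v, u, u', hv, hu, hu'⟩ := hden (ψ c) (ψ c')
    refine (hψ _).eq hR hcore (a := a₁ * r * a₂) (b := b₁ * r * a₂ + a₁ * r * b₂) hr ?_ hv
      (u := u + u') (by rw [mul_add, hu, hu', RingHom.map_add]) fun x => ?_
    · simp only [map_add, map_mul, add_smul, ← h₁, ← h₂, mul_smul_comm, smul_mul_assoc]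
    · have e₁ := P.mul_mem_right _ (x • a₂) (P.mul_mem_right _ (x • r) (hψ c u v hu a₁ b₁ h₁ x))
      have e₂ := P.mul_mem_left (x • a₁ * x • r) _ (hψ c' u' v hu' a₂ b₂ h₂ x)
      convert P.add_mem e₁ e₂ using 1
      change v.1 x • x • (b₁ * r * a₂ + a₁ * r * b₂) - (u.1 x + u'.1 x) • x • (a₁ * r * a₂) = _
      simp only [smul_add, smul_mul', sub_mul, mul_sub, smul_mul_assoc, mul_smul_comm, add_smul]
      abel
  have hmul : ∀ c c', ψ (c * c') = ψ c * ψ c' := fun c c' => by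
    obtain ⟨a₁, b₁, r, a₂, b₂, hr, h₁, h₂⟩ := hcommon c c'
    obtain ⟨v, u, u', hv, hu, hu'⟩ := hden (ψ c) (ψ c')
    refine (hψ _).eq hR hcore (a := a₁ * r * a₂) (b := b₁ * r * b₂) hr ?_ (mul_ne_zero hv hv)
      (u := u * u') (by rw [map_mul, map_mul, ← hu, ← hu']; ring) fun x => ?_
    · simp only [map_mul, mul_smul, ← h₁, ← h₂, mul_smul_comm, smul_mul_assoc]
      exact smul_comm _ _ _
    · have e₁ := P.mul_mem_right _ (v.1 x • x • b₂)
        (P.mul_mem_right _ (x • r) (hψ c u v hu a₁ b₁ h₁ x))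
      have e₂ := P.mul_mem_left (u.1 x • x • a₁ * x • r) _ (hψ c' u' v hu' a₂ b₂ h₂ x)
      convert P.add_mem e₁ e₂ using 1
      change (v.1 x * v.1 x) • x • (b₁ * r * b₂) - (u.1 x * u'.1 x) • x • (a₁ * r * a₂) = _
      simp only [smul_mul', sub_mul, mul_sub, smul_mul_assoc, mul_smul_comm, mul_smul, smul_sub]
      rw [smul_comm (v.1 x) (u.1 x), smul_comm (u'.1 x) (u.1 x)]
      abel
  exact ⟨{ toFun := ψ
           map_one' := by rw [← map_one (algebraMap k F), hcomm, map_one]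
           map_zero' := by rw [← map_zero (algebraMap k F), hcomm, map_zero]
           map_add' := hadd
           map_mul' := hmul
           commutes' := hcomm }, hψ⟩

end Forward

/-! ### The rational ideal attached to an equivariant homomorphism -/

section Backward

open scoped TensorProduct

variable {k : Type*} [Field k] {G : Type*} [Group G] [AffineAlgebraicGroup k G]
  {R : Type*} [Ring R] [Algebra k R]
  {K : Type*} [Field K] [Algebra (regularFunctions k G) K] [Algebra k K]
  [IsScalarTower k (regularFunctions k G) K]
  {F : Type*} [Field F] [Algebra k F] [Algebra F K] [IsScalarTower k F K] {Q : Type*}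
  [Ring Q] [Algebra F Q] {ι : R →+* Q} (hk : ∀ (l : k) (a : R), ι (l • a) = algebraMap k F l • ι a)

variable (G K) in
/-- The homomorphism from `k[G] ⊗ R` to the tensor product of `K = k(G)` and `Q` over `F`, sending
`f ⊗ r` to `f ⊗ ι r`. Here `F` acts on `k(G)` through a given homomorphism `F → k(G)`. -/
def toFracTensor : RegularMaps k G R →ₐ[k] K ⊗[F] Q :=
  Algebra.TensorProduct.lift
    ((Algebra.TensorProduct.includeLeft : K →ₐ[k] _).comp
      (IsScalarTower.toAlgHom k (regularFunctions k G) K))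
    { toRingHom :=
        (Algebra.TensorProduct.includeRight : Q →ₐ[F] K ⊗[F] Q).toRingHom.comp ι
      commutes' := fun l => by
        change (1 : K) ⊗ₜ[F] ι (algebraMap k R l) = _
        rw [Algebra.algebraMap_eq_smul_one, hk, map_one, TensorProduct.tmul_smul,
          TensorProduct.smul_tmul', Algebra.TensorProduct.algebraMap_apply, Algebra.smul_def,
          mul_one, ← IsScalarTower.algebraMap_apply] }
    fun f r => by
      change _ ⊗ₜ[F] _ * _ ⊗ₜ[F] _ = _ ⊗ₜ[F] _ * _ ⊗ₜ[F] _
      rw [Algebra.TensorProduct.tmul_mul_tmul, Algebra.TensorProduct.tmul_mul_tmul, one_mul,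
        one_mul, mul_one, mul_one]

@[simp] theorem toFracTensor_tmul (f : regularFunctions k G) (r : R) :
    toFracTensor G K hk (f ⊗ₜ r) = algebraMap _ K f ⊗ₜ ι r := by
  refine (Algebra.TensorProduct.lift_tmul _ _ _ f r).trans ?_
  change _ ⊗ₜ[F] _ * _ ⊗ₜ[F] _ = _
  rw [Algebra.TensorProduct.tmul_mul_tmul, one_mul, mul_one]
  rfl

theorem toFracTensor_smul (f : regularFunctions k G) (A : RegularMaps k G R) :
    toFracTensor G K hk (f • A) = algebraMap _ K f • toFracTensor G K hk A := by
  induction A using TensorProduct.induction_on with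
  | zero => simp
  | tmul g r =>
    rw [TensorProduct.smul_tmul', toFracTensor_tmul, toFracTensor_tmul, TensorProduct.smul_tmul',
      smul_eq_mul, smul_eq_mul, map_mul]
  | add A A' h h' => rw [smul_add, map_add, map_add, smul_add, h, h']

variable [MulSemiringAction G R] [SMulCommClass G k R] (hR : IsRationalAction k G R)

variable (K) in
/-- The homomorphism `R → k(G) ⊗ Q` sending `r` to the class of the map `x ↦ x⁻¹ • r`. -/
def orbitHom : R →ₐ[k] K ⊗[F] Q :=
  (toFracTensor G K hk).comp (invCoaction hR)

theorem orbitHom_apply (r : R) : orbitHom K hk hR r = toFracTensor G K hk (invCoaction hR r) := rfl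

variable (K) in
/-- The kernel of the homomorphism `R → k(G) ⊗ Q`. -/
def orbitKer : TwoSidedIdeal R := TwoSidedIdeal.ker (orbitHom K hk hR)

theorem mem_orbitKer {r : R} : r ∈ orbitKer K hk hR ↔ orbitHom K hk hR r = 0 :=
  TwoSidedIdeal.mem_ker _

theorem toFracTensor_untwist_tmul (f : regularFunctions k G) (r : R) :
    toFracTensor G K hk (untwist hR (f ⊗ₜ r)) =
      algebraMap _ K f • orbitHom K hk hR r := by
  rw [untwist_tmul, toFracTensor_smul, orbitHom_apply]

/-- Since `R → k(G) ⊗ Q` kills `orbitKer`, untwisting a regular map with values in `orbitKer`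
gives an element that is killed in `k(G) ⊗ Q`. -/
theorem toFracTensor_eq_zero {A : RegularMaps k G R}
    (hA : ∀ x : G, x • evalMap k G R A x ∈ orbitKer K hk hR) : toFracTensor G K hk A = 0 := by
  obtain ⟨B, hB⟩ := hR.exists_twist A
  have hAB : untwist hR B = A := evalMap_ext fun x => by
    rw [evalMap_untwist, hB, inv_smul_smul]
  rw [← hAB]
  refine map_eq_zero_of_forall_mem
    (((toFracTensor G K hk).toLinearMap.toAddMonoidHom.comp (untwist hR).toAddMonoidHom))
    (idealSubmodule k (orbitKer K hk hR)) (fun f r hr => ?_) fun x => by rw [hB]; exact hA x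
  exact (toFracTensor_untwist_tmul hk hR f r).trans
    (by rw [(mem_orbitKer hk hR).1 hr, smul_zero])

theorem one_tmul_mem_span (r : R) : (1 ⊗ₜ ι r : K ⊗[F] Q) ∈
    Submodule.span K (Set.range (orbitHom K hk hR)) := by
  obtain ⟨B, hB⟩ := hR.exists_evalMap_eq r
  have hAB : untwist hR B = 1 ⊗ₜ r := evalMap_ext fun x => by
    rw [evalMap_untwist, hB, inv_smul_smul, evalMap_tmul]
    exact (one_smul k r).symm
  have key : ∀ B, toFracTensor G K hk (untwist hR B) ∈
      Submodule.span K (Set.range (orbitHom K hk hR)) := fun B => by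
    induction B using TensorProduct.induction_on with
    | zero => simp
    | tmul f r =>
      rw [toFracTensor_untwist_tmul]
      exact Submodule.smul_mem _ _ (Submodule.subset_span ⟨r, rfl⟩)
    | add B B' h h' => rw [map_add, map_add]; exact add_mem h h'
  have := key B
  rwa [hAB, toFracTensor_tmul, map_one] at this

/-- An identity `s D(r) t = s' D(r) t'`, where `D = orbitHom`, also holds with `1 ⊗ r` in place
of `D(r)`, since `1 ⊗ r` is a `k(G)`-linear combination of values of `D`. -/
theorem mul_one_tmul_mul_eq {s t s' t' : K ⊗[F] Q}
    (h : ∀ r, s * orbitHom K hk hR r * t = s' * orbitHom K hk hR r * t') (r : R) :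
    s * (1 ⊗ₜ ι r) * t = s' * (1 ⊗ₜ ι r) * t' := by
  have := one_tmul_mem_span (K := K) hk hR r
  generalize (1 ⊗ₜ ι r : K ⊗[F] Q) = y at this ⊢
  induction this using Submodule.span_induction with
  | mem x hx =>
    obtain ⟨r, rfl⟩ := hx
    exact h r
  | zero => simp
  | add x y _ _ hx hy => rw [mul_add, mul_add, add_mul, add_mul, hx, hy]
  | smul κ x _ hx => rw [mul_smul_comm, mul_smul_comm, smul_mul_assoc, smul_mul_assoc, hx]

variable {I : TwoSidedIdeal R} (h : IsMartindaleExtension F I ι)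
include h

/-- The ring `k(G) ⊗ Q` is prime, even when testing with values of `orbitHom` only. -/
theorem eq_zero_or_eq_zero_of_mul_orbitHom {s t : K ⊗[F] Q}
    (hst : ∀ r, s * orbitHom K hk hR r * t = 0) : s = 0 ∨ t = 0 :=
  h.eq_zero_or_eq_zero_of_mul fun r =>
    (mul_one_tmul_mul_eq hk hR (s' := 0) (t' := t)
      (fun r => by rw [hst, zero_mul, zero_mul]) r).trans (by rw [zero_mul, zero_mul])

variable (K) in
/-- If `r` lies in the core, then the constant map `r` is killed in `k(G) ⊗ Q`, that is,
`1 ⊗ r = 0`. -/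
theorem core_orbitKer (hI : IsStable G I) : core G (orbitKer K hk hR) = I := by
  refine le_antisymm (fun r hr => ?_) fun r hr => mem_core.2 fun g => ?_
  · rw [← h.eq_zero_iff]
    by_contra h0
    refine tmul_ne_zero (F := F) (one_ne_zero (α := K)) h0 ?_
    have := toFracTensor_eq_zero (K := K) hk hR (A := (1 : regularFunctions k G) ⊗ₜ r) fun x => by
      rw [evalMap_tmul]
      change x • (1 : k) • r ∈ _
      rw [one_smul]
      exact mem_core.1 hr x
    rwa [toFracTensor_tmul, map_one] at this
  · rw [mem_orbitKer, orbitHom_apply]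
    refine map_eq_zero_of_forall_mem (toFracTensor G K hk).toLinearMap.toAddMonoidHom
      (idealSubmodule k I) (fun f r hr => ?_)
      fun x => by rw [evalMap_invCoaction]; exact hI x⁻¹ _ (hI g _ hr)
    exact (toFracTensor_tmul hk f r).trans
      (by rw [(h.eq_zero_iff r).2 hr, TensorProduct.tmul_zero])

variable (K) in
theorem isPrimeIdeal_orbitKer (hI : IsStable G I) : IsPrimeIdeal (orbitKer K hk hR) := by
  refine isPrimeIdeal_of_mem_or_mem (fun htop => ?_) fun a b hab => ?_
  · refine h.isPrime.one_notMem ?_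
    rw [← core_orbitKer K hk hR h hI, htop]
    exact mem_core.2 fun g => TwoSidedIdeal.mem_top R
  · simp only [mem_orbitKer, map_mul] at hab ⊢
    exact eq_zero_or_eq_zero_of_mul_orbitHom hk hR h hab

omit h in
/-- Compatible actions of `G` on `k(G)` and `Q` induce an action on `k(G) ⊗ Q`, for which the image
of `orbitHom` is fixed. -/
theorem exists_addMonoidHom_orbitHom {ρ : G → K →+* K}
    (hρ : ∀ g f, ρ g (algebraMap _ K f) = algebraMap _ K (rightRegular k g f))
    {g : G} {s : F → F} {σ : Q →+ Q}
    (hσ : ∀ c q, σ (c • q) = s c • σ q) (hσι : ∀ r, σ (ι r) = ι (g • r))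
    (hs : ∀ c, algebraMap F K (s c) =
      ρ g (algebraMap F K c)) :
    ∃ τ : K ⊗[F] Q →+ K ⊗[F] Q,
      (∀ κ t, τ (κ • t) = ρ g κ • τ t) ∧
        ∀ r, τ (orbitHom K hk hR r) = orbitHom K hk hR r := by
  let τ : K ⊗[F] Q →+ K ⊗[F] Q :=
    TensorProduct.liftAddHom
      { toFun := fun κ =>
          { toFun := fun q => ρ g κ ⊗ₜ σ q
            map_zero' := by simp
            map_add' := fun q q' => by rw [map_add, TensorProduct.tmul_add] }
        map_zero' := by ext q; simp
        map_add' := fun κ κ' => by ext q; simp [TensorProduct.add_tmul] }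
      fun c κ q => by
        change ρ g (c • κ) ⊗ₜ[F] σ q = ρ g κ ⊗ₜ[F] σ (c • q)
        rw [hσ, TensorProduct.tmul_smul, TensorProduct.smul_tmul', Algebra.smul_def, map_mul, ← hs,
          ← Algebra.smul_def]
  have hτ : ∀ κ q, τ (κ ⊗ₜ q) = ρ g κ ⊗ₜ σ q := fun κ q => rfl
  have hτΦ : ∀ A, τ (toFracTensor G K hk A) = toFracTensor G K hk (diagAction g A) := fun A => by
    induction A using TensorProduct.induction_on with
    | zero => simp
    | tmul f r =>
      rw [toFracTensor_tmul, hτ, diagAction_tmul, toFracTensor_tmul, hρ,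
        hσι]
    | add A A' h h' => rw [map_add, map_add, map_add, map_add, h, h']
  refine ⟨τ, fun κ t => ?_, fun r => ?_⟩
  · induction t using TensorProduct.induction_on with
    | zero => simp
    | tmul x q =>
      rw [TensorProduct.smul_tmul', hτ, hτ, TensorProduct.smul_tmul', smul_eq_mul, smul_eq_mul,
        map_mul]
    | add t t' h h' => rw [smul_add, map_add, map_add, smul_add, h, h']
  · rw [orbitHom_apply, hτΦ, diagAction_invCoaction]

/-- For a bimodule graph `W` on `R` modulo `orbitKer`, the images of `a` and `b` in `k(G) ⊗ Q` are
proportional when `W a b`; the factor lies in `k`, as it is invariant under right translations. -/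
theorem isRational_orbitKer [IsDomain (regularFunctions k G)]
    [IsFractionRing (regularFunctions k G) K] (hI : IsStable G I)
    {ρ : G → K →+* K}
    (hρ : ∀ g f, ρ g (algebraMap _ K f) = algebraMap _ K (rightRegular k g f))
    (hσ : ∀ g : G, ∃ (s : F → F) (σ : Q →+ Q), (∀ c q, σ (c • q) = s c • σ q) ∧
      (∀ r, σ (ι r) = ι (g • r)) ∧ ∀ c, algebraMap F K (s c) =
        ρ g (algebraMap F K c)) :
    IsRational k (orbitKer K hk hR) := by
  refine isRational_of_exists_scalar (isPrimeIdeal_orbitKer K hk hR h hI) fun W hW => ?_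
  have hcomm : ∀ {a b a' b'}, W a b → W a' b' → ∀ r, orbitHom K hk hR b * orbitHom K hk hR r *
      orbitHom K hk hR a' = orbitHom K hk hR a * orbitHom K hk hR r * orbitHom K hk hR b' :=
    fun {a b a' b'} hab hab' r => by
      have := hW.mem (hW.sub (hW.mul_right (r * a') hab) (hW.mul_left (a * r) hab'))
        (by rw [mul_assoc, sub_self]; exact TwoSidedIdeal.zero_mem _)
      rw [mem_orbitKer, map_sub, sub_eq_zero, ← mul_assoc] at this
      simpa only [map_mul] using this
  obtain ⟨a₀, b₀, hab₀, ha₀⟩ := hW.exists_notMem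
  rw [mem_orbitKer] at ha₀
  obtain ⟨κ, hκ⟩ := h.exists_smul_eq_of_mul_comm ha₀
    (mul_one_tmul_mul_eq hk hR (hcomm hab₀ hab₀))
  -- The scalar `κ` is invariant because `orbitHom` takes invariant values.
  obtain ⟨l, rfl⟩ := exists_algebraMap_eq_of_right_invariant hρ κ fun g => by
    obtain ⟨s, σ, h1, h2, h3⟩ := hσ g
    obtain ⟨τ, hτ, hτ'⟩ := exists_addMonoidHom_orbitHom hk hR hρ h1 h2 h3
    have := congrArg τ hκ
    rw [hτ, hτ', hτ', hκ] at this
    exact (smul_left_injective K ha₀ this).symm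
  refine ⟨l, fun a b hab => ?_⟩
  rw [mem_orbitKer, map_sub]
  refine (eq_zero_or_eq_zero_of_mul_orbitHom hk hR h fun r => ?_).resolve_right ha₀
  rw [sub_mul, sub_mul, hcomm hab hab₀, hκ, map_smul, algebraMap_smul, mul_smul_comm,
    smul_mul_assoc, smul_mul_assoc, sub_self]

/-- The homomorphism attached to the ideal `orbitKer` is the given homomorphism `F → k(G)`. -/
theorem IsCentroidValue.eq_algebraMap [IsDomain (regularFunctions k G)]
    [IsFractionRing (regularFunctions k G) K] {c : F} {κ : K}
    (hc : IsCentroidValue k G ι (orbitKer K hk hR) c κ) : κ = algebraMap F _ c := by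
  obtain ⟨a, b, hab, ha⟩ := h.exists_smul_eq c
  obtain ⟨u, v, hv, rfl⟩ := IsFractionRing.div_surjective (A := regularFunctions k G) κ
  have hv' : algebraMap _ K v ≠ 0 := by
    rw [Ne, map_eq_zero_iff _ (IsFractionRing.injective _ _)]; exact nonZeroDivisors.ne_zero hv
  have := toFracTensor_eq_zero (K := K) hk hR (A := v ⊗ₜ b - u ⊗ₜ a) fun x => by
    rw [map_sub, Pi.sub_apply, evalMap_tmul, evalMap_tmul, smul_sub, smul_comm x, smul_comm x]
    exact hc u v (mul_div_cancel₀ _ hv') a b hab x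
  rw [map_sub, toFracTensor_tmul, toFracTensor_tmul, ← hab, ← TensorProduct.smul_tmul,
    ← TensorProduct.sub_tmul] at this
  by_contra hne
  refine tmul_ne_zero ?_ (mt (h.eq_zero_iff a).1 ha) this
  rw [Algebra.smul_def, sub_ne_zero]
  intro h0
  exact hne (by rw [div_eq_iff hv', h0])

end Backward

/-! ### The rational ideal is determined by its homomorphism -/

section Unique

open scoped TensorProduct

variable {k : Type*} [Field k] {G : Type*} [Group G] [AffineAlgebraicGroup k G]
  [IsDomain (regularFunctions k G)] {R : Type*} [Ring R] [Algebra k R]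
  {K : Type*} [Field K] [Algebra (regularFunctions k G) K] [IsFractionRing (regularFunctions k G) K]
  [Algebra k K] [IsScalarTower k (regularFunctions k G) K]
  {F : Type*} [Field F] [Algebra k F] [Algebra F K] [IsScalarTower k F K] {Q : Type*} [Ring Q]
  [Algebra F Q] {ι : R →+* Q} (hk : ∀ (l : k) (a : R), ι (l • a) = algebraMap k F l • ι a)

section Vanishing

omit [IsDomain (regularFunctions k G)] [IsFractionRing (regularFunctions k G) K]

/-- An element of the kernel of `k[G] ⊗ R → K ⊗ Q` is a sum of tensors `h i ⊗ r i` for which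
there is an expansion `h i = ∑ j, a i j • y j` with `a i j ∈ F`, `y j ∈ K`, such that
`∑ i, a i j • r i = 0` in `Q` for all `j`. -/
theorem exists_sum_of_toFracTensor_eq_zero {A : RegularMaps k G R}
    (hA : toFracTensor G K hk A = 0) :
    ∃ (S : Finset (regularFunctions k G × R)) (T : Finset K)
      (a : regularFunctions k G × R → K → F), A = ∑ i ∈ S, i.1 ⊗ₜ i.2 ∧
        (∀ i ∈ S, algebraMap _ K i.1 = ∑ y ∈ T, algebraMap F K (a i y) * y) ∧
          ∀ y, ∑ i ∈ S, a i y • ι i.2 = 0 := by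
  classical
  obtain ⟨S, rfl⟩ := TensorProduct.exists_finset A
  let Y := Module.Basis.ofVectorSpace F K
  let T := S.biUnion fun i => (Y.repr (algebraMap _ K i.1)).support
  have hinj : Function.Injective Y := Y.injective
  let a : regularFunctions k G × R → K → F := fun i y =>
    if h : ∃ j, Y j = y then Y.repr (algebraMap _ K i.1) h.choose else 0
  have ha : ∀ i j, a i (Y j) = Y.repr (algebraMap _ K i.1) j := fun i j => by
    have h : ∃ j', Y j' = Y j := ⟨j, rfl⟩
    simp only [a, dif_pos h]
    rw [hinj h.choose_spec]
  refine ⟨S, T.image Y, a, rfl, fun i hi => ?_, fun y => ?_⟩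
  · rw [Finset.sum_image fun _ _ _ _ h => hinj h]
    conv_lhs => rw [← Y.linearCombination_repr (algebraMap _ K i.1)]
    rw [Finsupp.linearCombination_apply, Finsupp.sum_of_support_subset (s := T) _
      (fun j hj => Finset.mem_biUnion.2 ⟨i, hi, hj⟩) _ (by simp)]
    exact Finset.sum_congr rfl fun j _ => by rw [ha, Algebra.smul_def]
  · by_cases hy : ∃ j, Y j = y
    · obtain ⟨j, rfl⟩ := hy
      have := congrArg (TensorProduct.lid F Q ∘ (Y.coord j).rTensor Q) hA
      simp only [Function.comp_apply, map_sum, toFracTensor_tmul, map_zero,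
        LinearMap.rTensor_tmul, TensorProduct.lid_tmul] at this
      simpa only [ha, Module.Basis.coord_apply] using this
    · exact Finset.sum_eq_zero fun i _ => by simp only [a, dif_neg hy, zero_smul]

end Vanishing

variable [MulSemiringAction G R] [SMulCommClass G k R] (hR : IsRationalAction k G R)
  {I : TwoSidedIdeal R} (h : IsMartindaleExtension F I ι)
  {P : TwoSidedIdeal R} (hP : IsPrimeIdeal P) (hcore : core G P = I)
  (hc : ∀ c : F, IsCentroidValue k G ι P c (algebraMap F K c))

omit [Algebra k F] in
include h in
/-- Finitely many elements of the extended centroid have a common denominator. -/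
theorem IsMartindaleExtension.exists_forall_smul_eq (s : Finset F) :
    ∃ a ∉ I, ∀ c ∈ s, ∃ b, c • ι a = ι b := by
  classical
  induction s using Finset.induction_on with
  | empty => exact ⟨1, h.isPrime.one_notMem, by simp⟩
  | insert c s _ ih =>
    obtain ⟨a, ha, hs⟩ := ih
    obtain ⟨a', b', hab', ha'⟩ := h.exists_smul_eq c
    obtain ⟨r, hr⟩ := h.isPrime.exists_mul_mul_notMem ha ha'
    refine ⟨a * r * a', hr, fun c' hc' => ?_⟩
    rcases Finset.mem_insert.1 hc' with rfl | hc'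
    · exact ⟨a * r * b', by rw [map_mul, map_mul _ _ b', ← hab', mul_smul_comm]⟩
    · obtain ⟨b, hb⟩ := hs c' hc'
      exact ⟨b * r * a', by simp only [map_mul, ← hb, smul_mul_assoc]⟩

include hR h hP hcore hc

/-- A relation `∑ i, a i • r i = 0` in `Q` with `a i ∈ F` gives, after multiplication by a common
denominator of the `a i`, a congruence modulo `P` at each point of `G`, because the homomorphism
`F → k(G)` is the one attached to `P`. -/
theorem forall_mem_of_toFracTensor_eq_zero {A : RegularMaps k G R}
    (hA : toFracTensor G K hk A = 0) (x : G) : x • evalMap k G R A x ∈ P := by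
  classical
  obtain ⟨S, T, a, hAS, hST, hι⟩ := exists_sum_of_toFracTensor_eq_zero hk hA
  let C : Finset F := (S ×ˢ T).image fun p => a p.1 p.2
  obtain ⟨b, hbI, hb⟩ := h.exists_forall_smul_eq C
  have hC : ∀ i ∈ S, ∀ y ∈ T, a i y ∈ C := fun i hi y hy =>
    Finset.mem_image.2 ⟨(i, y), Finset.mem_product.2 ⟨hi, hy⟩, rfl⟩
  obtain ⟨v, hv, hvCT⟩ := exists_common_denominator (k := k) (G := G)
    (C.image (algebraMap F K) ∪ T) id
  have hu : ∀ c : F, ∃ u : regularFunctions k G, c ∈ C →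
      algebraMap _ K v * algebraMap F K c = algebraMap _ K u := fun c => by
    by_cases hc : c ∈ C
    · obtain ⟨u, hu⟩ := hvCT _ (Finset.mem_union_left _ (Finset.mem_image_of_mem _ hc))
      exact ⟨u, fun _ => hu⟩
    · exact ⟨0, fun h => (hc h).elim⟩
  have hw : ∀ y : K, ∃ w : regularFunctions k G, y ∈ T →
      algebraMap _ K v * y = algebraMap _ K w := fun y => by
    by_cases hy : y ∈ T
    · obtain ⟨w, hw⟩ := hvCT _ (Finset.mem_union_right _ hy)
      exact ⟨w, fun _ => hw⟩
    · exact ⟨0, fun h => (hy h).elim⟩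
  choose u hu using hu
  choose w hw using hw
  have hvv : ∀ i ∈ S, v * v * i.1 = ∑ y ∈ T, u (a i y) * w y := fun i hi => by
    refine IsFractionRing.injective (regularFunctions k G) K ?_
    rw [map_mul, map_mul, hST i hi, map_sum, Finset.mul_sum]
    refine Finset.sum_congr rfl fun y hy => ?_
    rw [map_mul, ← hu _ (hC i hi y hy), ← hw y hy]
    ring
  -- As `P` is prime and `b` is not in its core, it suffices that `v(x)² (x.A(x)) r (x.b) ∈ P` for
  -- all `x ∈ G` and `r ∈ R`.
  obtain ⟨B, hB⟩ := hR.exists_twist A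
  obtain ⟨D, hD⟩ := hR.exists_evalMap_eq b
  have key : ∀ x r, (v * v).1 x • (x • evalMap k G R A x * r * x • b) ∈ P := fun x r => by
    have hrb : ∀ c ∈ C, ∃ b', c • ι (x⁻¹ • r * b) = ι b' := fun c hc => by
      obtain ⟨b', hb'⟩ := hb c hc
      exact ⟨x⁻¹ • r * b', by rw [map_mul, ← mul_smul_comm, hb', map_mul]⟩
    generalize hd : x⁻¹ • r * b = d at hrb
    have hd' : r * x • b = x • d := by rw [← hd, smul_mul', smul_inv_smul]
    rw [mul_assoc, hd', ← smul_mul']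
    have hb' : ∀ c : F, ∃ b', c ∈ C → c • ι d = ι b' := fun c => by
      by_cases hc : c ∈ C
      · exact (hrb c hc).imp fun _ h _ => h
      · exact ⟨0, fun h => (hc h).elim⟩
    choose b' hb' using hb'
    -- Modulo `P`, the element `v(x)² x.(A(x) d)` is `∑ y, w_y(x) v(x) x.(∑ i, r_i b'_{iy})`, where
    -- `b'_{iy} = a_{iy} d` and `∑ i, r_i b'_{iy}` vanishes in `Q` for all `y`.
    have e1 : (v * v).1 x • x • (evalMap k G R A x * d) = ∑ y ∈ T, ∑ i ∈ S,
        (w y).1 x • (x • i.2 * ((u (a i y)).1 x • x • d)) := by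
      rw [Finset.sum_comm, hAS, map_sum, Finset.sum_apply, Finset.sum_mul, Finset.smul_sum,
        Finset.smul_sum]
      refine Finset.sum_congr rfl fun i hi => ?_
      rw [evalMap_tmul, smul_mul_assoc, smul_comm x, smul_smul]
      have := congrFun (congrArg Subtype.val (hvv i hi)) x
      change (v * v).1 x * i.1.1 x = _ at this
      rw [this, AddSubmonoidClass.coe_finsetSum, Finset.sum_apply, Finset.sum_smul]
      refine Finset.sum_congr rfl fun y _ => ?_
      rw [mul_smul_comm, smul_smul, smul_mul', mul_comm]
      rfl
    have e2 : ∀ y ∈ T, ∑ i ∈ S, (v.1 x • x • (i.2 * b' (a i y))) ∈ P := fun y hy => by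
      rw [← Finset.smul_sum, ← Finset.smul_sum]
      refine smul_mem_ideal k P _ ((mem_core (P := P)).1 ?_ x)
      rw [hcore, ← h.eq_zero_iff, map_sum, ← zero_mul (ι d), ← hι y, Finset.sum_mul]
      refine Finset.sum_congr rfl fun i hi => ?_
      rw [map_mul, ← hb' _ (hC i hi y hy), mul_smul_comm, smul_mul_assoc]
    rw [e1]
    refine sum_mem fun y hy => ?_
    rw [← Finset.smul_sum]
    refine smul_mem_ideal k P _ ?_
    rw [← sub_add_cancel (∑ i ∈ S, x • i.2 * ((u (a i y)).1 x • x • d))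
      (∑ i ∈ S, (v.1 x • x • (i.2 * b' (a i y)))), ← Finset.sum_sub_distrib]
    refine P.add_mem (sum_mem fun i hi => ?_) (e2 y hy)
    have := P.neg_mem (P.mul_mem_left (x • i.2) _
      (hc (a i y) (u (a i y)) v (hu _ (hC i hi y hy)) d _ (hb' _ (hC i hi y hy)) x))
    convert this using 1
    rw [smul_mul' x i.2 (b' _), mul_sub, neg_sub, mul_smul_comm (v.1 x)]
  have hbP : ¬∀ x : G, evalMap k G R D x ∈ idealSubmodule k P := fun hx =>
    hbI (hcore ▸ mem_core.2 fun g => hD g ▸ hx g)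
  have hvB := (forall_mem_or_forall_mem ((v * v) • B) D (idealSubmodule k P) (idealSubmodule k P)
    fun x => ?_).resolve_right hbP
  · rw [← hB]
    exact (eq_zero_or_forall_mem (v * v) B (idealSubmodule k P)
      fun x => by rw [← evalMap_smul]; exact hvB x).resolve_left (mul_ne_zero hv hv) x
  · rw [evalMap_smul, hB, hD]
    refine hP.mem_or_mem fun r => ?_
    rw [smul_mul_assoc, smul_mul_assoc]
    exact key x r

/-- Otherwise the subbimodule of `k(G) ⊗ Q` generated by such elements `A` would contain `1 ⊗ a` for
some `a ∈ R` outside the core `I` of `P`. -/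
theorem toFracTensor_eq_zero_of_forall_mem {A : RegularMaps k G R}
    (hA : ∀ x : G, x • evalMap k G R A x ∈ P) : toFracTensor G K hk A = 0 := by
  by_contra hne
  -- The fractions `Φ(B) / f`, with `x • B(x) ∈ P` for all `x`, form a subspace that is stable
  -- under multiplication by `R`.
  let N : Submodule K ((K ⊗[F] Q) × (K ⊗[F] Q)) :=
    { carrier := {z | ∃ (f : regularFunctions k G) (B : RegularMaps k G R), f ≠ 0 ∧
        (∀ x : G, x • evalMap k G R B x ∈ P) ∧ algebraMap _ K f • z.1 = toFracTensor G K hk B}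
      zero_mem' := ⟨1, 0, one_ne_zero, fun x => by simp, by simp⟩
      add_mem' := by
        rintro z z' ⟨f, B, hf, hB, hz⟩ ⟨f', B', hf', hB', hz'⟩
        refine ⟨f * f', f' • B + f • B', mul_ne_zero hf hf', fun x => ?_, ?_⟩
        · rw [map_add, Pi.add_apply, evalMap_smul, evalMap_smul, smul_add, smul_comm x,
            smul_comm x]
          exact P.add_mem (smul_mem_ideal k P _ (hB x)) (smul_mem_ideal k P _ (hB' x))
        · rw [map_add, toFracTensor_smul, toFracTensor_smul, ← hz, ← hz', Prod.fst_add, smul_add,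
            map_mul, smul_smul, smul_smul, mul_comm (algebraMap _ K f')]
      smul_mem' := by
        rintro κ z ⟨f, B, hf, hB, hz⟩
        obtain ⟨u, v, hv, rfl⟩ := IsFractionRing.div_surjective (A := regularFunctions k G) κ
        have hv' : algebraMap _ K v ≠ 0 := by
          rw [Ne, map_eq_zero_iff _ (IsFractionRing.injective _ _)]
          exact nonZeroDivisors.ne_zero hv
        refine ⟨v * f, u • B, mul_ne_zero (nonZeroDivisors.ne_zero hv) hf, fun x => ?_, ?_⟩
        · rw [evalMap_smul, smul_comm x]
          exact smul_mem_ideal k P _ (hB x)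
        · rw [toFracTensor_smul, ← hz, Prod.smul_fst, smul_smul, smul_smul, map_mul]
          congr 1
          field_simp }
  obtain ⟨a, ha, _, f, B, hf, hB, hfB⟩ := h.exists_mem_of_ne_zero (N := N)
    (t := toFracTensor G K hk A) (t' := 0)
    (by
      rintro r z ⟨f, B, hf, hB, hz⟩
      refine ⟨f, (1 ⊗ₜ r) * B, hf, fun x => ?_, ?_⟩
      · rw [map_mul, Pi.mul_apply, smul_mul']
        exact P.mul_mem_left _ _ (hB x)
      · rw [map_mul, ← hz, toFracTensor_tmul, map_one, mul_smul_comm])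
    (by
      rintro r z ⟨f, B, hf, hB, hz⟩
      refine ⟨f, B * (1 ⊗ₜ r), hf, fun x => ?_, ?_⟩
      · rw [map_mul, Pi.mul_apply, smul_mul']
        exact P.mul_mem_right _ _ (hB x)
      · rw [map_mul, ← hz, toFracTensor_tmul, map_one, smul_mul_assoc])
    ⟨1, A, one_ne_zero, hA, by rw [map_one, one_smul]⟩ hne
  -- Hence `x • a ∈ P` for all `x`, although `a` is not in the core `I` of `P`.
  have h0 := forall_mem_of_toFracTensor_eq_zero hk hR h hP hcore hc (A := f ⊗ₜ a - B) (by
    rw [map_sub, toFracTensor_tmul, ← hfB, TensorProduct.smul_tmul', smul_eq_mul, mul_one,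
      sub_self])
  obtain ⟨D, hD⟩ := hR.exists_evalMap_eq a
  refine ha (hcore ▸ mem_core.2 fun g => ?_)
  have := (eq_zero_or_forall_mem f D (idealSubmodule k P) fun x => ?_).resolve_left hf g
  · rwa [hD] at this
  · have := P.add_mem (h0 x) (hB x)
    rwa [← smul_add, map_sub, Pi.sub_apply, sub_add_cancel, evalMap_tmul, smul_comm, ← hD]
      at this

/-- If the given homomorphism `F → k(G)` is the one attached to `P`, then `P` is the kernel of
`R → k(G) ⊗ Q`. -/
theorem eq_orbitKer : P = orbitKer K hk hR := by
  refine TwoSidedIdeal.ext fun r => ?_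
  have hr : ∀ x : G, x • evalMap k G R (invCoaction hR r) x = r := fun x => by
    rw [evalMap_invCoaction, smul_inv_smul]
  rw [mem_orbitKer, orbitHom_apply]
  refine ⟨fun hrP => toFracTensor_eq_zero_of_forall_mem hk hR h hP hcore hc fun x => ?_,
    fun h0 => ?_⟩
  · rwa [hr]
  · have := forall_mem_of_toFracTensor_eq_zero hk hR h hP hcore hc h0 1
    rwa [hr] at this

end Unique

/-! ### Equivariance, and the correspondence for a fixed extended centroid -/

section Correspondence

variable {k : Type*} [Field k] {G : Type*} [Group G] [AffineAlgebraicGroup k G]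
  [IsDomain (regularFunctions k G)] {R : Type*} [Ring R] [Algebra k R]
  [MulSemiringAction G R] [SMulCommClass G k R]
  {K : Type*} [Field K] [Algebra (regularFunctions k G) K] [IsFractionRing (regularFunctions k G) K]
  {F : Type*} [CommRing F] {Q : Type*} [Ring Q] [Algebra F Q] {I P : TwoSidedIdeal R} {ι : R →+* Q}
  (hR : IsRationalAction k G R) (h : IsMartindaleExtension F I ι)

include hR h

/-- The homomorphism attached to `P` is equivariant for the right regular action. -/
theorem IsCentroidValue.eq_rightRegular (hcore : core G P = I) {g : G} {c c' : F}
    (hc : ∀ a b, c • ι a = ι b → c' • ι (g • a) = ι (g • b)) (hI : IsStable G I)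
    {κ κ' : K} (hκ : IsCentroidValue k G ι P c κ) (hκ' : IsCentroidValue k G ι P c' κ')
    {ρ : K →+* K} (hρ : ∀ f, ρ (algebraMap _ K f) = algebraMap _ K (rightRegular k g f)) :
    κ' = ρ κ := by
  obtain ⟨a, b, hab, ha⟩ := h.exists_smul_eq c
  obtain ⟨v, hv, huv⟩ := exists_common_denominator (k := k) (G := G) {κ} id
  obtain ⟨u, hu⟩ := huv κ (Finset.mem_singleton_self κ)
  refine hκ'.eq hR hcore (fun hga => ha ?_) (hc a b hab)
    (u := rightRegular k g u) (v := rightRegular k g v)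
    ((map_ne_zero_iff _ (rightRegular k g).injective).2 hv) ?_ fun x => ?_
  · simpa using hI g⁻¹ _ hga
  · rw [← hρ, ← hρ, ← hu, map_mul, id]
  · have := hκ u v hu a b hab (x * g)
    rwa [mul_smul, mul_smul] at this

/-- The homomorphism attached to `g.P` is obtained by left translation from the one attached
to `P`. -/
theorem IsCentroidValue.eq_leftRegular (hcore : core G P = I) {g : G} {c : F}
    {κ κ' : K} (hκ : IsCentroidValue k G ι P c κ)
    (hκ' : IsCentroidValue k G ι (translate g P) c κ')
    {ρ : K →+* K} (hρ : ∀ f, ρ (algebraMap _ K f) = algebraMap _ K (leftRegular k g f)) :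
    κ' = ρ κ := by
  obtain ⟨a, b, hab, ha⟩ := h.exists_smul_eq c
  obtain ⟨v, hv, huv⟩ := exists_common_denominator (k := k) (G := G) {κ} id
  obtain ⟨u, hu⟩ := huv κ (Finset.mem_singleton_self κ)
  refine hκ'.eq hR ((core_translate P g).trans hcore) ha hab
    (u := leftRegular k g u) (v := leftRegular k g v)
    ((map_ne_zero_iff _ (leftRegular k g).injective).2 hv) ?_ fun x => ?_
  · rw [← hρ, ← hρ, ← hu, map_mul, id]
  · rw [mem_translate, smul_sub, smul_comm g⁻¹ _ (x • b), smul_comm g⁻¹ _ (x • a), ← mul_smul,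
      ← mul_smul]
    exact hκ u v hu a b hab (g⁻¹ * x)

variable [Algebra k F] [Algebra k K] [IsScalarTower k (regularFunctions k G) K]
  (hF : IsField F) (hk : ∀ (l : k) (a : R), ι (l • a) = algebraMap k F l • ι a) (ψ : F →ₐ[k] K)
include hF hk

omit h in
/-- Every equivariant homomorphism is attached to some rational ideal with core `I`. -/
theorem exists_rational_of_algHom (h : IsMartindaleExtension F I ι) (hI : IsStable G I)
    {ρ : G → K →+* K}
    (hρ : ∀ g f, ρ g (algebraMap _ K f) = algebraMap _ K (rightRegular k g f))
    (hσ : ∀ g : G, ∃ (s : F → F) (σ : Q →+ Q), (∀ c q, σ (c • q) = s c • σ q) ∧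
      (∀ r, σ (ι r) = ι (g • r)) ∧ ∀ c, ψ (s c) = ρ g (ψ c)) :
    ∃ P, IsRational k P ∧ core G P = I ∧ ∀ c κ, IsCentroidValue k G ι P c κ → κ = ψ c := by
  -- Choose a field structure on `F` that extends the given ring structure.
  obtain ⟨inst, rfl⟩ : ∃ f : Field F, f.toCommRing = ‹CommRing F› := ⟨hF.toField, rfl⟩
  let : Algebra F K := ψ.toRingHom.toAlgebra
  have : IsScalarTower k F K := IsScalarTower.of_algebraMap_eq fun l => (ψ.commutes l).symm
  exact ⟨orbitKer K hk hR, isRational_orbitKer hk hR h hI hρ hσ, core_orbitKer K hk hR h hI,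
    fun c κ hκ => hκ.eq_algebraMap hk hR h⟩

omit h in
/-- A rational ideal with core `I` is determined by the homomorphism attached to it. -/
theorem eq_of_isCentroidValue (h : IsMartindaleExtension F I ι) {P' : TwoSidedIdeal R}
    (hP : IsPrimeIdeal P) (hP' : IsPrimeIdeal P') (hcore : core G P = I) (hcore' : core G P' = I)
    (hψ : ∀ c, IsCentroidValue k G ι P c (ψ c)) (hψ' : ∀ c, IsCentroidValue k G ι P' c (ψ c)) :
    P = P' := by
  -- Choose a field structure on `F` that extends the given ring structure.
  obtain ⟨inst, rfl⟩ : ∃ f : Field F, f.toCommRing = ‹CommRing F› := ⟨hF.toField, rfl⟩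
  let : Algebra F K := ψ.toRingHom.toAlgebra
  have : IsScalarTower k F K := IsScalarTower.of_algebraMap_eq fun l => (ψ.commutes l).symm
  exact (eq_orbitKer hk hR h hP hcore hψ).trans (eq_orbitKer hk hR h hP' hcore' hψ').symm

end Correspondence

section CentroidAction

variable {k : Type*} [Field k] {G : Type*} [Group G] {R : Type*} [Ring R] [Algebra k R]
  [MulSemiringAction G R] [SMulCommClass G k R] {I : TwoSidedIdeal R}

theorem congr_residueAut_toMartindale (hI : IsStable G I) (g : G) (r : R) :
    MartindaleQuotient.congr (residueAut k hI g) (toMartindale I r) = toMartindale I (g • r) := by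
  refine MartindaleQuotient.mk_eq fun x _ _ => ?_
  simp only [PartialMap.eval_transport, PartialMap.eval_leftMul]
  refine (map_mul (residueAut k hI g) _ _).trans ?_
  exact congrArg₂ _ rfl ((residueAut k hI g).apply_symm_apply x)

theorem congr_residueAut_smul (hI : IsStable G I) (g : G) (c : ExtendedCentroid k (ResidueRing I))
    (q : MartindaleQuotient (ResidueRing I)) :
    MartindaleQuotient.congr (residueAut k hI g) (c • q) =
      centroidAction k hI g c • MartindaleQuotient.congr (residueAut k hI g) q :=
  map_mul (MartindaleQuotient.congr (residueAut k hI g)) c.1 q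

theorem toMartindale_smul (I : TwoSidedIdeal R) (l : k) (a : R) : toMartindale I (l • a) =
    algebraMap k (ExtendedCentroid k (ResidueRing I)) l • toMartindale I a := by
  rw [Algebra.smul_def, toMartindale_algebraMap_mul]

end CentroidAction

end RationalIdeals

open RationalIdeals

theorem mainTheorem2 {k : Type*} [Field k] [IsAlgClosed k]
    {G : Type*} [Group G] [RationalIdeals.AffineAlgebraicGroup k G]
    (hG : RationalIdeals.IsZariskiConnected k G)
    {R : Type*} [Ring R] [Algebra k R] [MulSemiringAction G R] [SMulCommClass G k R]
    (hR : RationalIdeals.IsRationalAction k G R)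
    (I : TwoSidedIdeal R) (hI : RationalIdeals.IsGRational k G I) :
    ∃ Φ : RationalIdeals.RatFibre k G I →[G]
        RationalIdeals.EquivariantHom k hI.isGPrime.isStable,
      Function.Bijective Φ := by
  have := hG.isDomain
  have hS := hI.isGPrime.isStable
  have h := isMartindaleExtension_toMartindale k (hI.isGPrime.isPrimeIdeal hR)
  have hF := h.isField (FaithfulSMul.algebraMap_injective _ _)
  have hk := toMartindale_smul (k := k) I
  have hex := fun P : RatFibre k G I =>
    exists_algHom_isCentroidValue (RationalFunctions k G) h hk hR P.2.1 P.2.2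
  choose ψ hψ using hex
  refine ⟨⟨fun P => ⟨ψ P, fun g c => ?_⟩, fun g P => Subtype.ext (AlgHom.ext fun c => ?_)⟩,
    fun P P' hPP' => ?_, fun ψ₀ => ?_⟩
  · refine (hψ P c).eq_rightRegular hR h P.2.2 (fun a b hab => ?_) hS (hψ P _)
      (ρ := (rightRegularFrac k g : _ →+* _)) (rightRegularFrac_algebraMap g)
    rw [← congr_residueAut_toMartindale (k := k) hS, ← congr_residueAut_smul, hab,
      congr_residueAut_toMartindale]
  · exact (hψ P c).eq_leftRegular hR h P.2.2 (hψ (g • P) c)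
      (ρ := (leftRegularFrac k g : _ →+* _)) (leftRegularFrac_algebraMap g)
  · have hψψ : ψ P = ψ P' := congrArg Subtype.val hPP'
    exact Subtype.ext (eq_of_isCentroidValue hR hF hk (ψ P) h P.2.1.isPrime P'.2.1.isPrime P.2.2
      P'.2.2 (hψ P) (hψψ ▸ hψ P'))
  · obtain ⟨P, hP, hcore, hval⟩ := exists_rational_of_algHom hR hF hk ψ₀.1 h hS
      (ρ := fun g => (rightRegularFrac k g : _ →+* _)) rightRegularFrac_algebraMap fun g =>
        ⟨centroidAction k hS g,
          (MartindaleQuotient.congr (residueAut k hS g)).toAddEquiv.toAddMonoidHom,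
          congr_residueAut_smul hS g, congr_residueAut_toMartindale hS g, ψ₀.2 g⟩
    exact ⟨⟨P, hP, hcore⟩, Subtype.ext (AlgHom.ext fun c => hval c _ (hψ ⟨P, hP, hcore⟩ c))⟩

end
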